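/- **Setting.** Let $m,n\ge 1$, $N=mn$. For convex functions $f_1,\dots,f_N:\mathbb R^d\to\mathbb R$, each $L$-smooth (differentiable with $L$-Lipschitz gradient), whose average $f=\frac1N\sum_{i=1}^N f_i$ is $\mu$-strongly convex, let $x^*$ be the minimizer of $f$ and $\kappa=L/\mu$. **The class $\mathcal F_\alpha$ ($\alpha\ge 0$).** An algorithm $\mathcal A\in\mathcal F_\alpha$ distributes the functions once, at the beginning: $[N]$ is partitioned uniformly at random into $S_1,\dots,S_m$ with $|S_j|=n$; independently, for each $j$, a multiset $R_j$ of $\alpha n$ indices (rounded down if $\alpha n$ is not an integer) is sampled uniformly from $[N]$ with replacement; machine $j$ holds the functions with indices in the multiset $S_j'=S_j\cup R_j$. Machine $j$ keeps a set of vectors $W_j$, initially $\{0\}$. In each round, machine $j$ may add to $W_j$, finitely but arbitrarily many times, any vector $w$ such that, for some $F_j=\sum_{i\in U_j}f_i$ with $U_j\subset S'_j$ and some $\gamma>0$, $\nu\ge 0$, $$\gamma w+\nu\nabla F_j(w)\in\mathrm{span}\{\,w',\ \nabla F_j(w'),\ (\nabla^2F_j(w')+D)w'',\ (\nabla^2F_j(w')+D)^{-1}w''\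 :\ w',w''\in W_j,\ D\text{ diagonal}\,\},$$ where the Hessian and inverse terms are used whenever they exist. At the end of the round every machine may add to its set any vectors from the other machines' sets. The output $\mathcal A(\{f_i\},H)$ after $H$ rounds is a vector in the linear span of one $W_j$. The choices may be randomized and may use any information. **Theorem.** Let $\alpha\ge0$, $\mu>0$, $n\ge 1$, $\kappa=L/\mu\ge n$, and $$m\ge\max\Big\{\exp\Big(\tfrac{\alpha}{\max\{1,\alpha\}}e^{\frac{2}{\max\{1,\alpha\}}+1}\Big),\ (e+\max\{1,\alpha\})^2\Big\}.$$ For every $\epsilon>0$ and every $r>0$ there are $b\ge1$, a vector $w^*\in\mathbb R^b$ with $\|w^*\|=r$, and $N=mn$ convex $L$-smooth functions $f_1,\dots,f_N$ on $\mathbb R^{nb}$ with $\mu$-strongly convex average $f$ and minimizer $x^*=(w^*,\dots,w^*)$ ($n$ copies, so that $n\|w^*\|^2=\|x^*\|^2$), such that for every $\mathcal A\in\mathcal F_\alpha$ and every number of rounds $H$: if $\hat x=\mathcal A(\{f_i\},H)$ satisfies $\mathbb E[f(\hat x)-f(x^*)]\le\epsilon$, then $$H\ \ge\ B:=\frac{\sqrt{\kappa/n-1}}{4\sqrt2\,\big((e+\max\{1,\alpha\})\log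 m\big)^{3/2}}\ \log\Big(c_\alpha\,\frac{\mu n\|w^*\|^2}{4\epsilon}\Big),\qquad c_\alpha=1-\frac1{(e+e^\alpha)(e+\max\{1,\alpha\})^2}.$$ In particular, an algorithm in $\mathcal F_\alpha$ that reaches expected accuracy $\epsilon$ on every such problem needs at least $B$ rounds on this one. Moreover $B\ge\Omega\big(\sqrt{\kappa/(n(\log m)^3)}\,\log(\mu n\|w^*\|^2/\epsilon)\big)$ in the following sense: for every $\delta>0$ there is $c>0$, depending only on $\alpha$ and $\delta$, such that $B\ge c\sqrt{\frac{\kappa}{n(\log m)^3}}\log\frac{\mu n\|w^*\|^2}{\epsilon}$ for all $m$ above the threshold, all $n\ge1$, and all $L,\mu,\epsilon,r=\|w^*\|>0$ with $\kappa\ge(1+\delta)n$ and $4(1+\delta)\epsilon\le c_\alpha\,\mu n\|w^*\|^2$. -/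

import Mathlib

open MeasureTheory

universe u

noncomputable section

namespace DistOpt

/-- The average `f(x) = (1/N) ∑ᵢ fᵢ(x)` of `N = m * n` functions on `ℝ^d`. -/
def average {m n d : ℕ} (f : Fin (m * n) → EuclideanSpace ℝ (Fin d) → ℝ)
    (x : EuclideanSpace ℝ (Fin d)) : ℝ :=
  (1 / ((m : ℝ) * (n : ℝ))) * ∑ i, f i x

/-- `g` is `L`-smooth: differentiable, with an `L`-Lipschitz gradient. -/
def IsSmooth {d : ℕ} (L : ℝ) (g : EuclideanSpace ℝ (Fin d) → ℝ) : Prop :=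
  Differentiable ℝ g ∧ ∀ x y, ‖gradient g x - gradient g y‖ ≤ L * ‖x - y‖

/-- The problem class: `m * n` convex, `L`-smooth functions on `ℝ^d` whose average is
`μ`-strongly convex. -/
def IsInstance {m n d : ℕ} (L μ : ℝ) (f : Fin (m * n) → EuclideanSpace ℝ (Fin d) → ℝ) : Prop :=
  (∀ i, ConvexOn ℝ Set.univ (f i)) ∧ (∀ i, IsSmooth L (f i)) ∧
    StrongConvexOn Set.univ μ (average f)

/-- An outcome of the data distribution stage: a partition of the `m * n` indices into `m` parts
of size `n` (given by the map sending an index to the machine that owns it), and for each machine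
a sequence of `r` further indices (repetitions allowed). -/
abbrev DataDistribution (m n r : ℕ) : Type :=
  {σ : Fin (m * n) → Fin m // ∀ j, (Finset.univ.filter fun i => σ i = j).card = n} ×
    (Fin m → Fin r → Fin (m * n))

/-- The multiset `S'_j` of the indices held by machine `j`: its part `S_j` of the partition together
with its extra samples `R_j`, counted with multiplicity. -/
def localData {m n r : ℕ} (D : DataDistribution m n r) (j : Fin m) : Multiset (Fin (m * n)) :=
  (Finset.univ.filter fun i => D.1.1 i = j).val + Finset.univ.val.map (D.2 j)

/-- The partial sum `F = ∑_{i ∈ U} fᵢ` over a multiset `U` of indices. -/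
def partialSum {m n d : ℕ} (f : Fin (m * n) → EuclideanSpace ℝ (Fin d) → ℝ)
    (U : Multiset (Fin (m * n))) (x : EuclideanSpace ℝ (Fin d)) : ℝ :=
  (U.map fun i => f i x).sum

/-- The operator `∇²F(x) + diag(δ)` on `ℝ^d`; it is used only where `∇F` is differentiable. -/
def shiftedHessian {d : ℕ} (F : EuclideanSpace ℝ (Fin d) → ℝ) (x : EuclideanSpace ℝ (Fin d))
    (δ : Fin d → ℝ) : EuclideanSpace ℝ (Fin d) →ₗ[ℝ] EuclideanSpace ℝ (Fin d) :=
  (fderiv ℝ (gradient F) x : EuclideanSpace ℝ (Fin d) →ₗ[ℝ] EuclideanSpace ℝ (Fin d)) +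
    Matrix.toEuclideanLin (Matrix.diagonal δ)

/-- The generating vectors of a local update with the function `F` and the working set `W`:
`w'`, `∇F(w')`, `(∇²F(w') + D) w''` and `(∇²F(w') + D)⁻¹ w''` with `w', w'' ∈ W` and `D` diagonal,
whenever the Hessian (and the inverse) exists. -/
inductive IsDirection {d : ℕ} (F : EuclideanSpace ℝ (Fin d) → ℝ)
    (W : Set (EuclideanSpace ℝ (Fin d))) : EuclideanSpace ℝ (Fin d) → Prop
  | point {w' : EuclideanSpace ℝ (Fin d)} (h : w' ∈ W) : IsDirection F W w'
  | grad {w' : EuclideanSpace ℝ (Fin d)} (h : w' ∈ W) : IsDirection F W (gradient F w')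
  | hess {w' w'' : EuclideanSpace ℝ (Fin d)} (δ : Fin d → ℝ) (h' : w' ∈ W) (h'' : w'' ∈ W)
      (hd : DifferentiableAt ℝ (gradient F) w') :
      IsDirection F W (shiftedHessian F w' δ w'')
  | hessInv {w' w'' v : EuclideanSpace ℝ (Fin d)} (δ : Fin d → ℝ) (h' : w' ∈ W) (h'' : w'' ∈ W)
      (hd : DifferentiableAt ℝ (gradient F) w')
      (hinv : Function.Bijective (shiftedHessian F w' δ))
      (hv : shiftedHessian F w' δ v = w'') : IsDirection F W v

/-- A machine holding the data `S'` with working set `W` may add `w` to `W`: for some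
`F = ∑_{i ∈ U} fᵢ`, `U ⊆ S'`, and some `γ > 0`, `ν ≥ 0`, the vector `γ w + ν ∇F(w)` lies in the
span of the directions generated by `F` and `W`. -/
def CanAdd {m n d : ℕ} (f : Fin (m * n) → EuclideanSpace ℝ (Fin d) → ℝ)
    (S' : Multiset (Fin (m * n))) (W : Set (EuclideanSpace ℝ (Fin d)))
    (w : EuclideanSpace ℝ (Fin d)) : Prop :=
  ∃ U ≤ S', ∃ γ ν : ℝ, 0 < γ ∧ 0 ≤ ν ∧
    γ • w + ν • gradient (partialSum f U) w ∈
      Submodule.span ℝ {v | IsDirection (partialSum f U) W v}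

/-- The local computation of one machine in one round: finitely many (arbitrarily many) successive
additions to its working set. -/
def LocalComputation {m n d : ℕ} (f : Fin (m * n) → EuclideanSpace ℝ (Fin d) → ℝ)
    (S' : Multiset (Fin (m * n))) :
    Set (EuclideanSpace ℝ (Fin d)) → Set (EuclideanSpace ℝ (Fin d)) → Prop :=
  Relation.ReflTransGen fun W W' => ∃ w, CanAdd f S' W w ∧ W' = insert w W

/-- `ReachableIn f S' H W`: the machines, machine `j` holding the data `S' j`, can have the working
sets `W j` after `H` rounds. All start from `{0}`; a round is local computation on every machine,
followed by a simultaneous exchange in which each machine keeps its vectors and adds any vectors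
of the other machines. -/
inductive ReachableIn {m n d : ℕ} (f : Fin (m * n) → EuclideanSpace ℝ (Fin d) → ℝ)
    (S' : Fin m → Multiset (Fin (m * n))) :
    ℕ → (Fin m → Set (EuclideanSpace ℝ (Fin d))) → Prop
  | start : ReachableIn f S' 0 fun _ => {0}
  | round {H : ℕ} {W V W' : Fin m → Set (EuclideanSpace ℝ (Fin d))}
      (hW : ReachableIn f S' H W)
      (hloc : ∀ j, LocalComputation f (S' j) (W j) (V j))
      (hkeep : ∀ j, V j ⊆ W' j) (hrecv : ∀ j, W' j ⊆ ⋃ i, V i) :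
      ReachableIn f S' (H + 1) W'

/-- `x` is a possible output after `H` rounds: it lies in the span of one working set. -/
def IsOutput {m n d : ℕ} (f : Fin (m * n) → EuclideanSpace ℝ (Fin d) → ℝ)
    (S' : Fin m → Multiset (Fin (m * n))) (H : ℕ) (x : EuclideanSpace ℝ (Fin d)) : Prop :=
  ∃ W, ReachableIn f S' H W ∧ ∃ j, x ∈ Submodule.span ℝ (W j)

/-- The family `F_α` of distributed (extended) first-order algorithms on `m` machines for
`N = m * n` functions. The data are distributed once, by a uniformly random even partition and,
independently, `α n` (rounded down if it is not an integer) uniform samples with replacement for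
each machine. Applied to functions `f` on any `ℝ^d` for `H` rounds, the algorithm returns a random
vector that obeys the rules above; its choices may use further randomness and any information. -/
structure Algorithm (m n : ℕ) (α : ℝ) where
  /-- The sample space, carrying the randomness of the data and of the algorithm itself. -/
  Ω : Type u
  [measurableSpace : MeasurableSpace Ω]
  /-- The probability measure on the sample space. -/
  P : Measure Ω
  [isProbabilityMeasure : IsProbabilityMeasure P]
  /-- The random outcome of the data distribution stage. -/
  data : Ω → DataDistribution m n ⌊α * (n : ℝ)⌋₊
  measurableSet_data : ∀ D, MeasurableSet (data ⁻¹' {D})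
  data_uniform : ∀ D, P (data ⁻¹' {D}) =
    ((Fintype.card (DataDistribution m n ⌊α * (n : ℝ)⌋₊) : ENNReal))⁻¹
  /-- The output of the algorithm on the functions `f` after `H` rounds. -/
  output : ∀ {d : ℕ}, (Fin (m * n) → EuclideanSpace ℝ (Fin d) → ℝ) → ℕ → Ω →
    EuclideanSpace ℝ (Fin d)
  measurable_output : ∀ {d : ℕ} (f : Fin (m * n) → EuclideanSpace ℝ (Fin d) → ℝ) (H : ℕ),
    Measurable (output f H)
  output_valid : ∀ {d : ℕ} (f : Fin (m * n) → EuclideanSpace ℝ (Fin d) → ℝ) (H : ℕ) (ω : Ω),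
    IsOutput f (localData (data ω)) H (output f H ω)

attribute [instance] Algorithm.measurableSpace Algorithm.isProbabilityMeasure

/-- The expected accuracy `E[f(x̂) - f(x*)]` of the output after `H` rounds. For a minimizer `x*` the
integrand is nonnegative, and the expectation may be `∞`. -/
def expectedGap {m n : ℕ} {α : ℝ} (A : Algorithm.{u} m n α) {d : ℕ}
    (f : Fin (m * n) → EuclideanSpace ℝ (Fin d) → ℝ) (xstar : EuclideanSpace ℝ (Fin d)) (H : ℕ) :
    ENNReal :=
  ∫⁻ ω, ENNReal.ofReal (average f (A.output f H ω) - average f xstar) ∂A.P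

/-- The vector `(w, …, w)` of `ℝ^{n b}` made of `n` consecutive copies of `w ∈ ℝ^b`. -/
def copies (n : ℕ) {b : ℕ} (w : EuclideanSpace ℝ (Fin b)) : EuclideanSpace ℝ (Fin (n * b)) :=
  WithLp.toLp 2 fun i => w (finProdFinEquiv.symm i).2

/-- The threshold `max {exp(α / max{1,α} · e^{2 / max{1,α} + 1}), (e + max{1,α})²}` for `m`. -/
def machineThreshold (α : ℝ) : ℝ :=
  max (Real.exp (α / max 1 α * Real.exp (2 / max 1 α + 1))) ((Real.exp 1 + max 1 α) ^ 2)

/-- The constant `1 - 1 / ((e + e^α) (e + max{1,α})²)`. -/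
def probConst (α : ℝ) : ℝ :=
  1 - 1 / ((Real.exp 1 + Real.exp α) * (Real.exp 1 + max 1 α) ^ 2)

/-- The lower bound
`√(κ/n - 1) / (4 √2 ((e + max{1,α}) log m)^{3/2}) · log (probConst α · μ n r² / (4 ε))`,
with `κ = L / μ`, where `r` stands for `‖w*‖`. -/
def roundsBound (α : ℝ) (m n : ℕ) (L μ ε r : ℝ) : ℝ :=
  Real.sqrt (L / μ / (n : ℝ) - 1) /
      (4 * Real.sqrt 2 * ((Real.exp 1 + max 1 α) * Real.log (m : ℝ)) ^ (3 / 2 : ℝ)) *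
    Real.log (probConst α * (μ * (n : ℝ) * r ^ 2 / (4 * ε)))

end DistOpt

end

/-! The hard functions are quadratics on `n` independent blocks of `ℝ^b`, with `m` functions acting
on each block. Summed over a block, their Hessians give a multiple of the identity, the Laplacian of
a path on the coordinates, and a correction at the last coordinate; the linear terms act only on the
first coordinate. The minimizer is then a geometric sequence `ρ θ ^ i` in every block
(`sum_hardOp_geometric`). The edges of the path are coloured by position modulo `k`, where `k` is `T
= (e + max {1, α}) log m` rounded up, and each function carries the edges of at most one colour.

Vectors whose `l`-th block is supported on the first `t` coordinates form a space that can only be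
left through the edge of colour `t % k`. A machine with fewer than `k` functions of block `l` lacks
one of any `k` consecutive colours (`exists_missing_class`), and every permitted local operation,
implicit steps and inverse Hessians included, preserves a coordinate subspace that is invariant
under the local data (`CanAdd.mem_of_invariant`). So one round, however much is computed in it,
extends the support by at most `k - 1` coordinates (`IsOutput.mem_of_chain`,
`IsOutput.mem_blockSubspace`).

A Chernoff estimate for even partitions and for samples with replacement shows that a given block is
crowded, meaning that some machine holds at least `k` of its functions, with probability at most `1
- probConst α` (`card_crowded_le`, `crowding_bound`). Every uncrowded block misses the tail of the
minimizer beyond coordinate `H (k - 1)`, whose squared norm exceeds `θ ^ (2 H (k - 1)) r² / 2`.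
Strong convexity and linearity of expectation turn this into a lower bound on the expected accuracy
(`le_expectedGap`), and `-log θ ≤ √(8 T / (κ / n - 1))` turns that into a bound on `H`. The
dimension `b` depends only on the claimed bound, so the instance serves all algorithms and all `H`
at once. -/

noncomputable section

namespace DistOpt

/-! ### Quadratic functions -/

section Quadratic

variable {E : Type*} [NormedAddCommGroup E] [InnerProductSpace ℝ E]

/-- The quadratic function `x ↦ ½ ⟪A x, x⟫ - ⟪c, x⟫`. -/
def quadratic (A : E →L[ℝ] E) (c : E) (x : E) : ℝ :=
  1 / 2 * inner ℝ (A x) x - inner ℝ c x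

/-- A symmetric and positive semidefinite operator. -/
structure IsSymmPos (A : E →L[ℝ] E) : Prop where
  symm : ∀ x y, inner ℝ (A x) y = inner ℝ x (A y)
  nonneg : ∀ x, 0 ≤ inner ℝ (A x) x

lemma IsSymmPos.zero : IsSymmPos (0 : E →L[ℝ] E) := ⟨by simp, by simp⟩

lemma IsSymmPos.add {A B : E →L[ℝ] E} (hA : IsSymmPos A) (hB : IsSymmPos B) :
    IsSymmPos (A + B) :=
  ⟨fun x y => by simp [inner_add_left, inner_add_right, hA.symm, hB.symm],
    fun x => by
      simpa [inner_add_left] using add_nonneg (hA.nonneg x) (hB.nonneg x)⟩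

lemma IsSymmPos.smul {A : E →L[ℝ] E} (hA : IsSymmPos A) {t : ℝ} (ht : 0 ≤ t) :
    IsSymmPos (t • A) :=
  ⟨fun x y => by simp [inner_smul_left, inner_smul_right, hA.symm],
    fun x => by simpa [inner_smul_left] using mul_nonneg ht (hA.nonneg x)⟩

lemma IsSymmPos.multiset_sum {ι : Type*} {A : ι → E →L[ℝ] E} (hA : ∀ i, IsSymmPos (A i))
    (U : Multiset ι) : IsSymmPos (U.map A).sum := by
  induction U using Multiset.induction_on with
  | empty => simpa using IsSymmPos.zero
  | cons i U ih => simpa using (hA i).add ih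

lemma IsSymmPos.sum {ι : Type*} {A : ι → E →L[ℝ] E} (s : Finset ι)
    (hA : ∀ i, IsSymmPos (A i)) : IsSymmPos (∑ i ∈ s, A i) :=
  IsSymmPos.multiset_sum hA s.val

lemma quadratic_multiset_sum {ι : Type*} (A : ι → E →L[ℝ] E) (c : ι → E) (U : Multiset ι) (x : E) :
    (U.map fun i => quadratic (A i) (c i) x).sum = quadratic (U.map A).sum (U.map c).sum x := by
  induction U using Multiset.induction_on with
  | empty => simp [quadratic]
  | cons i U ih =>
    simp only [Multiset.map_cons, Multiset.sum_cons, ih]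
    simp only [quadratic, add_apply, inner_add_left]
    ring

lemma quadratic_sum {ι : Type*} (A : ι → E →L[ℝ] E) (c : ι → E) (s : Finset ι) (x : E) :
    ∑ i ∈ s, quadratic (A i) (c i) x = quadratic (∑ i ∈ s, A i) (∑ i ∈ s, c i) x :=
  quadratic_multiset_sum A c s.val x

lemma mul_quadratic (t : ℝ) (A : E →L[ℝ] E) (c x : E) :
    t * quadratic A c x = quadratic (t • A) (t • c) x := by
  simp [quadratic, inner_smul_left]
  ring

lemma quadratic_sub_quadratic {A : E →L[ℝ] E} (hA : IsSymmPos A) {c y : E} (hy : A y = c) (x : E) :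
    quadratic A c x - quadratic A c y = 1 / 2 * inner ℝ (A (x - y)) (x - y) := by
  subst hy
  have h := hA.symm y x
  have h2 := real_inner_comm (A x) y
  simp only [quadratic, map_sub, inner_sub_left, inner_sub_right]
  linarith

lemma convexOn_quadratic {A : E →L[ℝ] E} (hA : IsSymmPos A) (c : E) :
    ConvexOn ℝ Set.univ (quadratic A c) := by
  refine ⟨convex_univ, fun x _ y _ s t hs ht hst => ?_⟩
  have h := mul_nonneg (mul_nonneg hs ht) (hA.nonneg (x - y))
  have h1 := hA.symm x y
  have h2 := real_inner_comm (A y) x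
  obtain rfl : t = 1 - s := by linarith
  simp only [quadratic, map_sub, map_add, map_smul, inner_sub_left, inner_sub_right, inner_add_left,
    inner_add_right, real_inner_smul_left, real_inner_smul_right, smul_eq_mul] at h ⊢
  rw [h1, h2] at h ⊢
  linarith

lemma strongConvexOn_quadratic {A : E →L[ℝ] E} (hA : IsSymmPos A) (c : E) {μ : ℝ}
    (hμ : ∀ x, μ * ‖x‖ ^ 2 ≤ inner ℝ (A x) x) : StrongConvexOn Set.univ μ (quadratic A c) := by
  rw [strongConvexOn_iff_convex]
  have hB : IsSymmPos (A - μ • ContinuousLinearMap.id ℝ E) := by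
    refine ⟨fun x y => ?_, fun x => ?_⟩
    · simp [inner_sub_left, inner_sub_right, inner_smul_left, inner_smul_right, hA.symm]
    · have := hμ x
      simp only [sub_apply, smul_apply,
        ContinuousLinearMap.id_apply, inner_sub_left, real_inner_smul_left,
        real_inner_self_eq_norm_sq]
      linarith
  convert convexOn_quadratic hB c using 2 with x
  simp only [quadratic, sub_apply, smul_apply,
    ContinuousLinearMap.id_apply, inner_sub_left, real_inner_smul_left, real_inner_self_eq_norm_sq]
  ring

variable [CompleteSpace E]

lemma hasGradientAt_quadratic {A : E →L[ℝ] E} (hA : IsSymmPos A) (c x : E) :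
    HasGradientAt (quadratic A c) (A x - c) x := by
  rw [hasGradientAt_iff_hasFDerivAt]
  have h1 : HasFDerivAt (fun y => inner ℝ (A y) y) _ x := (A.hasFDerivAt).inner ℝ (hasFDerivAt_id x)
  have h2 : HasFDerivAt (fun y => inner ℝ c y) (innerSL ℝ c) x := (innerSL ℝ c).hasFDerivAt
  have h := (h1.const_mul (1 / 2)).sub h2
  refine h.congr_fderiv ?_
  ext v
  have h3 := hA.symm v x
  have h4 := real_inner_comm (A x) v
  simp [fderivInnerCLM_apply]
  linarith

lemma gradient_quadratic {A : E →L[ℝ] E} (hA : IsSymmPos A) (c : E) :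
    gradient (quadratic A c) = fun x => A x - c :=
  gradient_eq fun x => hasGradientAt_quadratic hA c x

lemma hasFDerivAt_gradient_quadratic {A : E →L[ℝ] E} (hA : IsSymmPos A) (c x : E) :
    HasFDerivAt (gradient (quadratic A c)) A x := by
  rw [gradient_quadratic hA]
  exact A.hasFDerivAt.sub_const c

end Quadratic

lemma isSmooth_quadratic {d : ℕ}
    {A : EuclideanSpace ℝ (Fin d) →L[ℝ] EuclideanSpace ℝ (Fin d)} (hA : IsSymmPos A)
    (c : EuclideanSpace ℝ (Fin d)) {L : ℝ} (hL : ∀ x, ‖A x‖ ≤ L * ‖x‖) :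
    IsSmooth L (quadratic A c) := by
  refine ⟨fun x => (hasGradientAt_quadratic hA c x).differentiableAt, fun x y => ?_⟩
  rw [gradient_quadratic hA]
  simpa using hL (x - y)

/-- An instance made of quadratic functions, whose average has a given minimizer. -/
lemma isInstance_quadratic {m n d : ℕ} {L μ : ℝ}
    {A : Fin (m * n) → EuclideanSpace ℝ (Fin d) →L[ℝ] EuclideanSpace ℝ (Fin d)}
    (c : Fin (m * n) → EuclideanSpace ℝ (Fin d)) (hA : ∀ i, IsSymmPos (A i))
    (hL : ∀ i x, ‖A i x‖ ≤ L * ‖x‖) (hm : 0 < m) (hn : 0 < n)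
    (hμ : ∀ x, (m * n : ℝ) * μ * ‖x‖ ^ 2 ≤ ∑ i, inner ℝ (A i x) x) :
    IsInstance L μ fun i => quadratic (A i) (c i) := by
  refine ⟨fun i => convexOn_quadratic (hA i) _, fun i => isSmooth_quadratic (hA i) _ (hL i), ?_⟩
  have hN : (0 : ℝ) < m * n := by positivity
  have : average (fun i => quadratic (A i) (c i)) =
      quadratic ((1 / ((m : ℝ) * n)) • ∑ i, A i) ((1 / ((m : ℝ) * n)) • ∑ i, c i) := by
    ext x
    rw [average, quadratic_sum, mul_quadratic]
  rw [this]
  refine strongConvexOn_quadratic ((IsSymmPos.sum _ hA).smul (by positivity)) _ fun x => ?_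
  have h := hμ x
  simp only [smul_apply, sum_apply, real_inner_smul_left,
    sum_inner]
  rw [one_div, ← div_eq_inv_mul, le_div_iff₀ hN]
  linarith

lemma average_quadratic_sub {m n d : ℕ}
    {A : Fin (m * n) → EuclideanSpace ℝ (Fin d) →L[ℝ] EuclideanSpace ℝ (Fin d)}
    {c : Fin (m * n) → EuclideanSpace ℝ (Fin d)} (hA : ∀ i, IsSymmPos (A i))
    {y : EuclideanSpace ℝ (Fin d)} (hy : ∑ i, A i y = ∑ i, c i) (x : EuclideanSpace ℝ (Fin d)) :
    average (fun i => quadratic (A i) (c i)) x - average (fun i => quadratic (A i) (c i)) y =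
      1 / ((m : ℝ) * n) * (1 / 2 * ∑ i, inner ℝ (A i (x - y)) (x - y)) := by
  have h := quadratic_sub_quadratic (IsSymmPos.sum Finset.univ hA) (c := ∑ i, c i) (y := y)
    (by simpa using hy) x
  rw [average, average, ← mul_sub, quadratic_sum, quadratic_sum, h, sum_apply, sum_inner]

/-! ### The span of the reachable vectors -/

/-- In finite dimension an injective map that sends `V` into `V` sends it onto `V`. This is why
inverse Hessians and implicit steps give no more than Hessians and gradients. -/
lemma mem_of_injective_of_mapsTo {E : Type*} [AddCommGroup E] [Module ℝ E]
    [FiniteDimensional ℝ E] {T : E →ₗ[ℝ] E} (hT : Function.Injective T) {V : Submodule ℝ E}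
    (hV : ∀ x ∈ V, T x ∈ V) {v : E} (hv : T v ∈ V) : v ∈ V := by
  have hsurj : Function.Surjective (T.restrict hV) :=
    LinearMap.surjective_of_injective fun x y hxy =>
      Subtype.ext (hT (congrArg Subtype.val hxy))
  obtain ⟨w, hw⟩ := hsurj ⟨T v, hv⟩
  have : T w = T v := congrArg Subtype.val hw
  exact hT this ▸ w.2

section Reach

variable {m n d : ℕ}
  {A : Fin (m * n) → EuclideanSpace ℝ (Fin d) →L[ℝ] EuclideanSpace ℝ (Fin d)}
  {c : Fin (m * n) → EuclideanSpace ℝ (Fin d)} {V : Submodule ℝ (EuclideanSpace ℝ (Fin d))}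

lemma partialSum_quadratic (U : Multiset (Fin (m * n))) :
    partialSum (fun i => quadratic (A i) (c i)) U = quadratic (U.map A).sum (U.map c).sum :=
  funext fun x => quadratic_multiset_sum A c U x

lemma multiset_sum_apply_mem {U : Multiset (Fin (m * n))} (hU : ∀ i ∈ U, ∀ x ∈ V, A i x ∈ V)
    {x : EuclideanSpace ℝ (Fin d)} (hx : x ∈ V) : (U.map A).sum x ∈ V := by
  induction U using Multiset.induction_on with
  | empty => simp
  | cons i U ih =>
    simp only [Multiset.map_cons, Multiset.sum_cons, add_apply]
    exact V.add_mem (hU i (by simp) x hx) (ih fun j hj => hU j (by simp [hj]))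

/-- All directions are built from maps preserving `V`: the local Hessian `B`, diagonal matrices, and
inverses of their sums. The implicit step is solved by `γ + ν B`, which also preserves `V` and is
injective because `γ > 0` and `B` is positive semidefinite. -/
lemma CanAdd.mem_of_invariant (hA : ∀ i, IsSymmPos (A i))
    (hD : ∀ (δ : Fin d → ℝ), ∀ x ∈ V, Matrix.toEuclideanLin (Matrix.diagonal δ) x ∈ V)
    {S : Multiset (Fin (m * n))} (hS : ∀ i ∈ S, (∀ x ∈ V, A i x ∈ V) ∧ c i ∈ V)
    {W : Set (EuclideanSpace ℝ (Fin d))} (hW : W ⊆ V) {w : EuclideanSpace ℝ (Fin d)}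
    (hw : CanAdd (fun i => quadratic (A i) (c i)) S W w) : w ∈ V := by
  obtain ⟨U, hU, γ, ν, hγ, hν, hmem⟩ := hw
  rw [partialSum_quadratic] at hmem
  set B := (U.map A).sum with hB
  have hBp : IsSymmPos B := IsSymmPos.multiset_sum hA U
  have hBV : ∀ x ∈ V, B x ∈ V := fun x hx =>
    multiset_sum_apply_mem (fun i hi => (hS i (Multiset.mem_of_le hU hi)).1) hx
  have hcV : (U.map c).sum ∈ V := multiset_sum_mem _ fun y hy => by
    obtain ⟨i, hi, rfl⟩ := Multiset.mem_map.1 hy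
    exact (hS i (Multiset.mem_of_le hU hi)).2
  have hHess : ∀ w' δ, ∀ x ∈ V, shiftedHessian (quadratic B (U.map c).sum) w' δ x ∈ V := by
    intro w' δ x hx
    rw [shiftedHessian, (hasFDerivAt_gradient_quadratic hBp _ w').fderiv]
    exact V.add_mem (hBV x hx) (hD δ x hx)
  have hdir : Submodule.span ℝ {v | IsDirection (quadratic B (U.map c).sum) W v} ≤ V := by
    refine Submodule.span_le.2 fun v hv => ?_
    cases hv with
    | point h => exact hW h
    | grad h =>
      rw [gradient_quadratic hBp]
      exact V.sub_mem (hBV _ (hW h)) hcV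
    | hess δ h' h'' hd => exact hHess _ δ _ (hW h'')
    | hessInv δ h' h'' hd hinv hv =>
      exact mem_of_injective_of_mapsTo hinv.1 (hHess _ δ) (hv ▸ hW h'')
  have h1 : γ • w + ν • B w ∈ V := by
    have := V.add_mem (hdir hmem) (V.smul_mem ν hcV)
    rw [gradient_quadratic hBp] at this
    convert this using 1
    module
  let T : EuclideanSpace ℝ (Fin d) →ₗ[ℝ] EuclideanSpace ℝ (Fin d) :=
    γ • LinearMap.id + ν • (B : EuclideanSpace ℝ (Fin d) →ₗ[ℝ] EuclideanSpace ℝ (Fin d))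
  have hT : ∀ x, T x = γ • x + ν • B x := fun x => by simp [T]
  refine mem_of_injective_of_mapsTo (T := T) ?_ (fun x hx => ?_) (v := w) ?_
  · refine (injective_iff_map_eq_zero T).2 fun x hx => ?_
    have h0 : inner ℝ (T x) x = 0 := by simp [hx]
    rw [hT, inner_add_left, real_inner_smul_left, real_inner_smul_left,
      real_inner_self_eq_norm_sq] at h0
    have h2 := mul_nonneg hν (hBp.nonneg x)
    have h3 : γ * ‖x‖ ^ 2 ≤ 0 := by linarith
    have h4 : ‖x‖ ^ 2 ≤ 0 := by
      by_contra! h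
      exact absurd h3 (not_le.2 (mul_pos hγ h))
    exact norm_eq_zero.1 (pow_eq_zero_iff two_ne_zero |>.1 (le_antisymm h4 (sq_nonneg _)))
  · rw [hT]
    exact V.add_mem (V.smul_mem _ hx) (V.smul_mem _ (hBV x hx))
  · rwa [hT]

lemma LocalComputation.subset_of_invariant (hA : ∀ i, IsSymmPos (A i))
    (hD : ∀ (δ : Fin d → ℝ), ∀ x ∈ V, Matrix.toEuclideanLin (Matrix.diagonal δ) x ∈ V)
    {S : Multiset (Fin (m * n))} (hS : ∀ i ∈ S, (∀ x ∈ V, A i x ∈ V) ∧ c i ∈ V)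
    {W W' : Set (EuclideanSpace ℝ (Fin d))} (hW : W ⊆ V)
    (h : LocalComputation (fun i => quadratic (A i) (c i)) S W W') : W' ⊆ V := by
  induction h with
  | refl => exact hW
  | tail _ hstep ih =>
    obtain ⟨w, hw, rfl⟩ := hstep
    exact Set.insert_subset (hw.mem_of_invariant hA hD hS ih) ih

/-- If within any `K` consecutive members of an increasing sequence of coordinate subspaces each
machine meets one that is invariant under its data, then a round advances by at most `K`. -/
lemma IsOutput.mem_of_chain {V : ℕ → Submodule ℝ (EuclideanSpace ℝ (Fin d))} (hV : Monotone V)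
    (hA : ∀ i, IsSymmPos (A i))
    (hD : ∀ t (δ : Fin d → ℝ), ∀ x ∈ V t, Matrix.toEuclideanLin (Matrix.diagonal δ) x ∈ V t)
    {S : Fin m → Multiset (Fin (m * n))} {K : ℕ}
    (hS : ∀ j t, ∃ t', t ≤ t' ∧ t' ≤ t + K ∧
      ∀ i ∈ S j, (∀ x ∈ V t', A i x ∈ V t') ∧ c i ∈ V t')
    {H : ℕ} {x : EuclideanSpace ℝ (Fin d)}
    (hx : IsOutput (fun i => quadratic (A i) (c i)) S H x) : x ∈ V (H * K) := by
  obtain ⟨W, hW, j, hj⟩ := hx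
  suffices h : ∀ j, W j ⊆ V (H * K) from Submodule.span_le.2 (h j) hj
  clear hj j
  induction hW with
  | start => intro j; simp
  | @round H W V' W' hW hloc hkeep hrecv ih =>
    intro j
    refine (hrecv j).trans (Set.iUnion_subset fun i => ?_)
    -- Each machine has its own `t'`, but all of these lie below `H * K + K`, so the exchange stays
    -- in one member of the chain.
    obtain ⟨t', h1, h2, h3⟩ := hS i (H * K)
    have := LocalComputation.subset_of_invariant hA (hD t') h3 ((ih i).trans (hV h1)) (hloc i)
    exact this.trans (hV (h2.trans (by rw [Nat.succ_mul])))

end Reach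

/-! ### Diagonal and permutation operators -/

section Operators

variable {ι : Type*} [Fintype ι]

lemma toEuclideanLin_diagonal_apply [DecidableEq ι] (δ : ι → ℝ) (x : EuclideanSpace ℝ ι) (i : ι) :
    Matrix.toEuclideanLin (Matrix.diagonal δ) x i = δ i * x i := by
  simp [Matrix.toLpLin_apply, Matrix.mulVec_diagonal]

/-- The diagonal operator with entries `δ`. -/
def diagOp [DecidableEq ι] (δ : ι → ℝ) : EuclideanSpace ℝ ι →L[ℝ] EuclideanSpace ℝ ι :=
  LinearMap.toContinuousLinearMap (Matrix.toEuclideanLin (Matrix.diagonal δ))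

lemma diagOp_apply [DecidableEq ι] (δ : ι → ℝ) (x : EuclideanSpace ℝ ι) (i : ι) :
    diagOp δ x i = δ i * x i :=
  toEuclideanLin_diagonal_apply δ x i

lemma isSymmPos_diagOp [DecidableEq ι] {δ : ι → ℝ} (hδ : ∀ i, 0 ≤ δ i) : IsSymmPos (diagOp δ) := by
  refine ⟨fun x y => ?_, fun x => ?_⟩
  · simp only [PiLp.inner_apply, diagOp_apply, RCLike.inner_apply, conj_trivial]
    exact Finset.sum_congr rfl fun i _ => by ring
  · simp only [PiLp.inner_apply, diagOp_apply, RCLike.inner_apply, conj_trivial]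
    exact Finset.sum_nonneg fun i _ => by
      have := mul_nonneg (hδ i) (mul_self_nonneg (x i))
      linarith

lemma norm_diagOp_le [DecidableEq ι] {δ : ι → ℝ} (hδ : ∀ i, |δ i| ≤ 1) (x : EuclideanSpace ℝ ι) :
    ‖diagOp δ x‖ ≤ ‖x‖ := by
  rw [EuclideanSpace.norm_eq, EuclideanSpace.norm_eq]
  refine Real.sqrt_le_sqrt (Finset.sum_le_sum fun i _ => ?_)
  rw [diagOp_apply, norm_mul, Real.norm_eq_abs (δ i)]
  have := mul_le_of_le_one_left (norm_nonneg (x i)) (hδ i)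
  gcongr

/-- The operator `x ↦ x - x ∘ σ⁻¹`, the Laplacian of a perfect matching when `σ` is an
involution. -/
def exchangeOp (σ : Equiv.Perm ι) : EuclideanSpace ℝ ι →L[ℝ] EuclideanSpace ℝ ι :=
  ContinuousLinearMap.id ℝ _ -
    ((LinearIsometryEquiv.piLpCongrLeft 2 ℝ ℝ σ).toContinuousLinearEquiv :
      EuclideanSpace ℝ ι →L[ℝ] EuclideanSpace ℝ ι)

lemma exchangeOp_apply (σ : Equiv.Perm ι) (x : EuclideanSpace ℝ ι) (i : ι) :
    exchangeOp σ x i = x i - x (σ.symm i) := by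
  simp [exchangeOp, LinearIsometryEquiv.piLpCongrLeft_apply]

lemma exchangeOp_eq (σ : Equiv.Perm ι) (x : EuclideanSpace ℝ ι) :
    exchangeOp σ x = x - LinearIsometryEquiv.piLpCongrLeft 2 ℝ ℝ σ x := rfl

lemma norm_exchangeOp_le (σ : Equiv.Perm ι) (x : EuclideanSpace ℝ ι) :
    ‖exchangeOp σ x‖ ≤ 2 * ‖x‖ := by
  rw [exchangeOp_eq]
  refine (norm_sub_le _ _).trans ?_
  rw [LinearIsometryEquiv.norm_map]
  linarith

/-- Positivity is Cauchy–Schwarz, since permuting coordinates is an isometry; symmetry needs `σ` to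
be its own inverse. -/
lemma isSymmPos_exchangeOp {σ : Equiv.Perm ι} (hσ : Function.Involutive σ) :
    IsSymmPos (exchangeOp σ) := by
  have hs : ∀ i, σ.symm i = σ i := fun i => by rw [Equiv.symm_apply_eq, hσ i]
  refine ⟨fun x y => ?_, fun x => ?_⟩
  · simp only [PiLp.inner_apply, exchangeOp_apply, RCLike.inner_apply, conj_trivial, hs, mul_sub,
      sub_mul, Finset.sum_sub_distrib]
    congr 1
    rw [← Equiv.sum_comp σ]
    exact Finset.sum_congr rfl fun i _ => by rw [hσ i]
  · rw [exchangeOp_eq, inner_sub_left, real_inner_self_eq_norm_sq]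
    have := real_inner_le_norm (LinearIsometryEquiv.piLpCongrLeft 2 ℝ ℝ σ x) x
    rw [LinearIsometryEquiv.norm_map] at this
    nlinarith

end Operators

/-! ### The chain -/

/-- The involution of `{0, …, b - 1}` that exchanges `t - 1` and `t` for all `t ≡ r` modulo `k`. -/
def adjFun (b k r : ℕ) (i : Fin b) : Fin b :=
  if h : 1 ≤ i.val ∧ i.val % k = r then ⟨i.val - 1, by omega⟩
  else if h : i.val + 1 < b ∧ (i.val + 1) % k = r then ⟨i.val + 1, h.1⟩ else i

lemma succ_mod_ne {k : ℕ} (hk : 2 ≤ k) (i : ℕ) : (i + 1) % k ≠ i % k := by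
  intro h
  have h1 : (i + 1) ≡ i + 0 [MOD k] := h
  have h2 : 1 ≡ 0 [MOD k] := Nat.ModEq.add_left_cancel' i h1
  rw [Nat.modEq_zero_iff_dvd, Nat.dvd_one] at h2
  omega

/-- For `k ≥ 2` adjacent edges have different classes, so the edges of one class form a matching. -/
lemma adjFun_involutive {b k : ℕ} (hk : 2 ≤ k) (r : ℕ) : Function.Involutive (adjFun b k r) := by
  intro i
  by_cases h : 1 ≤ i.val ∧ i.val % k = r
  · have e : adjFun b k r i = ⟨i.val - 1, by omega⟩ := dif_pos h
    have h1 := succ_mod_ne hk (i.val - 1)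
    rw [Nat.sub_add_cancel h.1, h.2] at h1
    rw [e, adjFun, dif_neg (fun h' => h1 h'.2.symm), dif_pos]
    · ext
      simp only
      omega
    · simp only [Nat.sub_add_cancel h.1, h.2, and_true]
      omega
  · by_cases h2 : i.val + 1 < b ∧ (i.val + 1) % k = r
    · have e : adjFun b k r i = ⟨i.val + 1, h2.1⟩ := by rw [adjFun, dif_neg h, dif_pos h2]
      rw [e, adjFun, dif_pos]
      · ext
        simp
      · exact ⟨by simp, h2.2⟩
    · have e : adjFun b k r i = i := by rw [adjFun, dif_neg h, dif_neg h2]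
      rw [e, e]

/-- `adjFun` as a permutation. -/
def adjPerm (b : ℕ) {k : ℕ} (hk : 2 ≤ k) (r : ℕ) : Equiv.Perm (Fin b) :=
  (adjFun_involutive hk r).toPerm

lemma exchangeOp_adjPerm_apply {b k : ℕ} (hk : 2 ≤ k) (r : ℕ) (x : EuclideanSpace ℝ (Fin b))
    (i : Fin b) : exchangeOp (adjPerm b hk r) x i = x i - x (adjFun b k r i) := by
  rw [exchangeOp_apply]
  rfl

/-- The vectors of `ℝ^b` supported on the first `t` coordinates. -/
def initialSubspace (b t : ℕ) : Submodule ℝ (EuclideanSpace ℝ (Fin b)) where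
  carrier := {x | ∀ i : Fin b, t ≤ i.val → x i = 0}
  add_mem' hx hy i hi := by simp [hx i hi, hy i hi]
  zero_mem' i _ := rfl
  smul_mem' a x hx i hi := by simp [hx i hi]

lemma initialSubspace_mono (b : ℕ) : Monotone (initialSubspace b) :=
  fun _ _ hst _ hx i hi => hx i (hst.trans hi)

lemma diagOp_mem_initialSubspace {b t : ℕ} (δ : Fin b → ℝ) {x : EuclideanSpace ℝ (Fin b)}
    (hx : x ∈ initialSubspace b t) : diagOp δ x ∈ initialSubspace b t :=
  fun i hi => by rw [diagOp_apply, hx i hi, mul_zero]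

/-- The only edge that leaves the first `t` coordinates joins `t - 1` to `t`, and its class is `t %
k`. -/
lemma exchangeOp_mem_initialSubspace {b k t r : ℕ} (hk : 2 ≤ k) (hr : t % k ≠ r)
    {x : EuclideanSpace ℝ (Fin b)} (hx : x ∈ initialSubspace b t) :
    exchangeOp (adjPerm b hk r) x ∈ initialSubspace b t := by
  intro i hi
  rw [exchangeOp_adjPerm_apply, hx i hi, hx, sub_zero]
  unfold adjFun
  split_ifs with h1 h2
  · have : t ≠ i.val := fun h => hr (h ▸ h1.2)
    simp only
    omega
  · simp only
    omega
  · exact hi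

/-- The difference with the neighbours joined to `i` by edges of class `r`. -/
lemma sub_adjFun {b k : ℕ} (hk : 2 ≤ k) (r : ℕ) (x : ℕ → ℝ) (i : Fin b) :
    x i - x (adjFun b k r i) =
      (if i.val % k = r then (if 1 ≤ i.val then x i - x (i.val - 1) else 0) else 0) +
      (if (i.val + 1) % k = r then (if i.val + 1 < b then x i - x (i.val + 1) else 0) else 0) := by
  have h0 := succ_mod_ne hk i.val
  unfold adjFun
  split_ifs <;> simp_all

/-- The operator of one component function on `ℝ^b`: `ν` times the identity, `a` times the edges
of the chain of class `r`, and `β` times the last coordinate. -/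
def chainOp (b : ℕ) {k : ℕ} (hk : 2 ≤ k) (ν a β : ℝ) (r : ℕ) :
    EuclideanSpace ℝ (Fin b) →L[ℝ] EuclideanSpace ℝ (Fin b) :=
  ν • ContinuousLinearMap.id ℝ _ + (a • exchangeOp (adjPerm b hk r) +
    β • diagOp fun i : Fin b => if i.val + 1 = b then 1 else 0)

section ChainOp

variable {b k : ℕ} {hk : 2 ≤ k} {ν a β : ℝ} {r : ℕ}

lemma isSymmPos_id {E : Type*} [NormedAddCommGroup E] [InnerProductSpace ℝ E] :
    IsSymmPos (ContinuousLinearMap.id ℝ E) :=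
  ⟨fun _ _ => rfl, fun _ => real_inner_self_nonneg⟩

lemma isSymmPos_chainOp_aux (ha : 0 ≤ a) (hβ : 0 ≤ β) :
    IsSymmPos (a • exchangeOp (adjPerm b hk r) +
      β • diagOp fun i : Fin b => if i.val + 1 = b then (1 : ℝ) else 0) :=
  ((isSymmPos_exchangeOp (adjFun_involutive hk r)).smul ha).add
    ((isSymmPos_diagOp fun i => by split_ifs <;> norm_num).smul hβ)

lemma isSymmPos_chainOp (hν : 0 ≤ ν) (ha : 0 ≤ a) (hβ : 0 ≤ β) :
    IsSymmPos (chainOp b hk ν a β r) :=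
  (isSymmPos_id.smul hν).add (isSymmPos_chainOp_aux ha hβ)

lemma le_inner_chainOp (ha : 0 ≤ a) (hβ : 0 ≤ β) (x : EuclideanSpace ℝ (Fin b)) :
    ν * ‖x‖ ^ 2 ≤ inner ℝ (chainOp b hk ν a β r x) x := by
  have h := (isSymmPos_chainOp_aux (b := b) (hk := hk) (r := r) ha hβ).nonneg x
  rw [chainOp, add_apply, inner_add_left]
  simp only [smul_apply, ContinuousLinearMap.id_apply, real_inner_smul_left,
    real_inner_self_eq_norm_sq]
  linarith

lemma norm_chainOp_le (hν : 0 ≤ ν) (ha : 0 ≤ a) (hβ : 0 ≤ β) (x : EuclideanSpace ℝ (Fin b)) :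
    ‖chainOp b hk ν a β r x‖ ≤ (ν + 2 * a + β) * ‖x‖ := by
  have h1 := norm_exchangeOp_le (adjPerm b hk r) x
  have h2 : ‖diagOp (fun i : Fin b => if i.val + 1 = b then (1 : ℝ) else 0) x‖ ≤ ‖x‖ :=
    norm_diagOp_le (fun i => by split_ifs <;> simp) x
  rw [chainOp, add_apply, add_apply, smul_apply, smul_apply, smul_apply]
  refine (norm_add_le_of_le le_rfl (norm_add_le _ _)).trans ?_
  rw [norm_smul, norm_smul, norm_smul, Real.norm_of_nonneg hν, Real.norm_of_nonneg ha,
    Real.norm_of_nonneg hβ, ContinuousLinearMap.id_apply]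
  have := mul_le_mul_of_nonneg_left h1 ha
  have := mul_le_mul_of_nonneg_left h2 hβ
  linarith

lemma chainOp_mem_initialSubspace {t : ℕ} (h : t % k ≠ r)
    {x : EuclideanSpace ℝ (Fin b)} (hx : x ∈ initialSubspace b t) :
    chainOp b hk ν a β r x ∈ initialSubspace b t := by
  rw [chainOp, add_apply, add_apply, smul_apply, smul_apply, smul_apply]
  exact Submodule.add_mem _ (Submodule.smul_mem _ _ hx) (Submodule.add_mem _
    (Submodule.smul_mem _ _ (exchangeOp_mem_initialSubspace hk h hx))
    (Submodule.smul_mem _ _ (diagOp_mem_initialSubspace _ hx)))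

lemma chainOp_apply (x : ℕ → ℝ) (i : Fin b) :
    chainOp b hk ν a β r (WithLp.toLp 2 fun j : Fin b => x j) i =
      ν * x i + a * ((if i.val % k = r then (if 1 ≤ i.val then x i - x (i.val - 1) else 0) else 0) +
        (if (i.val + 1) % k = r then (if i.val + 1 < b then x i - x (i.val + 1) else 0) else 0)) +
      β * (if i.val + 1 = b then x i else 0) := by
  rw [← sub_adjFun hk]
  simp [chainOp, exchangeOp_adjPerm_apply, diagOp_apply, add_assoc]

end ChainOp

/-! ### Blocks of coordinates -/

section Blocks

variable {n b : ℕ}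

/-- The `l`-th block of a vector of `ℝ^{n b}`. -/
def toBlock (b : ℕ) (l : Fin n) :
    EuclideanSpace ℝ (Fin (n * b)) →L[ℝ] EuclideanSpace ℝ (Fin b) :=
  LinearMap.toContinuousLinearMap
    { toFun := fun x => WithLp.toLp 2 fun j => x (finProdFinEquiv (l, j))
      map_add' := fun _ _ => rfl
      map_smul' := fun _ _ => rfl }

/-- The vector of `ℝ^{n b}` with a given `l`-th block and all other blocks zero. -/
def fromBlock (b : ℕ) (l : Fin n) :
    EuclideanSpace ℝ (Fin b) →L[ℝ] EuclideanSpace ℝ (Fin (n * b)) :=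
  LinearMap.toContinuousLinearMap
    { toFun := fun w => WithLp.toLp 2 fun p =>
        if (finProdFinEquiv.symm p).1 = l then w (finProdFinEquiv.symm p).2 else 0
      map_add' := fun v w => by
        ext p
        by_cases h : p.divNat = l <;> simp [h]
      map_smul' := fun a w => by
        ext p
        by_cases h : p.divNat = l <;> simp [h] }

lemma toBlock_apply (l : Fin n) (x : EuclideanSpace ℝ (Fin (n * b))) (j : Fin b) :
    toBlock b l x j = x (finProdFinEquiv (l, j)) := rfl

lemma fromBlock_apply (l : Fin n) (w : EuclideanSpace ℝ (Fin b)) (p : Fin (n * b)) :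
    fromBlock b l w p =
      if (finProdFinEquiv.symm p).1 = l then w (finProdFinEquiv.symm p).2 else 0 := rfl

lemma toBlock_fromBlock (l l' : Fin n) (w : EuclideanSpace ℝ (Fin b)) :
    toBlock b l (fromBlock b l' w) = if l = l' then w else 0 := by
  ext j
  rw [toBlock_apply, fromBlock_apply, Equiv.symm_apply_apply]
  split_ifs <;> rfl

lemma toBlock_copies (l : Fin n) (w : EuclideanSpace ℝ (Fin b)) : toBlock b l (copies n w) = w := by
  ext j
  rw [toBlock_apply, copies]
  simp

lemma ext_toBlock {x y : EuclideanSpace ℝ (Fin (n * b))}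
    (h : ∀ l, toBlock b l x = toBlock b l y) : x = y := by
  ext p
  have := congrArg (fun v => v (finProdFinEquiv.symm p).2) (h (finProdFinEquiv.symm p).1)
  simpa only [toBlock_apply, Prod.mk.eta, Equiv.apply_symm_apply] using this

lemma inner_fromBlock (l : Fin n) (w : EuclideanSpace ℝ (Fin b))
    (x : EuclideanSpace ℝ (Fin (n * b))) :
    inner ℝ (fromBlock b l w) x = inner ℝ w (toBlock b l x) := by
  simp only [PiLp.inner_apply]
  rw [← Equiv.sum_comp finProdFinEquiv, Fintype.sum_prod_type, Finset.sum_eq_single l]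
  · simp [fromBlock_apply, toBlock_apply]
  · intro l' _ hl
    simp [fromBlock_apply, hl]
  · simp

lemma norm_sq_eq_sum_toBlock (x : EuclideanSpace ℝ (Fin (n * b))) :
    ‖x‖ ^ 2 = ∑ l, ‖toBlock b l x‖ ^ 2 := by
  simp only [EuclideanSpace.norm_sq_eq]
  rw [← Equiv.sum_comp finProdFinEquiv, Fintype.sum_prod_type]
  rfl

lemma norm_toBlock_le (l : Fin n) (x : EuclideanSpace ℝ (Fin (n * b))) :
    ‖toBlock b l x‖ ≤ ‖x‖ := by
  refine le_of_sq_le_sq ?_ (norm_nonneg _)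
  rw [norm_sq_eq_sum_toBlock x]
  exact Finset.single_le_sum (f := fun l => ‖toBlock b l x‖ ^ 2) (fun _ _ => sq_nonneg _)
    (Finset.mem_univ l)

lemma norm_fromBlock (l : Fin n) (w : EuclideanSpace ℝ (Fin b)) : ‖fromBlock b l w‖ = ‖w‖ := by
  have h : ‖fromBlock b l w‖ ^ 2 = ‖w‖ ^ 2 := by
    rw [← real_inner_self_eq_norm_sq, inner_fromBlock, toBlock_fromBlock, if_pos rfl,
      real_inner_self_eq_norm_sq]
  exact (pow_left_inj₀ (norm_nonneg _) (norm_nonneg _) two_ne_zero).1 h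

/-- An operator acting on the `l`-th block. -/
def blockOp (l : Fin n) (A : EuclideanSpace ℝ (Fin b) →L[ℝ] EuclideanSpace ℝ (Fin b)) :
    EuclideanSpace ℝ (Fin (n * b)) →L[ℝ] EuclideanSpace ℝ (Fin (n * b)) :=
  fromBlock b l ∘L A ∘L toBlock b l

lemma blockOp_apply (l : Fin n) (A : EuclideanSpace ℝ (Fin b) →L[ℝ] EuclideanSpace ℝ (Fin b))
    (x : EuclideanSpace ℝ (Fin (n * b))) : blockOp l A x = fromBlock b l (A (toBlock b l x)) := rfl

lemma inner_blockOp (l : Fin n) (A : EuclideanSpace ℝ (Fin b) →L[ℝ] EuclideanSpace ℝ (Fin b))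
    (x y : EuclideanSpace ℝ (Fin (n * b))) :
    inner ℝ (blockOp l A x) y = inner ℝ (A (toBlock b l x)) (toBlock b l y) := by
  rw [blockOp_apply, inner_fromBlock]

lemma IsSymmPos.blockOp {A : EuclideanSpace ℝ (Fin b) →L[ℝ] EuclideanSpace ℝ (Fin b)}
    (hA : IsSymmPos A) (l : Fin n) : IsSymmPos (blockOp l A) :=
  ⟨fun x y => by
    rw [inner_blockOp, hA.symm, real_inner_comm, real_inner_comm _ x, inner_blockOp],
    fun x => by rw [inner_blockOp]; exact hA.nonneg _⟩

lemma norm_blockOp_le {A : EuclideanSpace ℝ (Fin b) →L[ℝ] EuclideanSpace ℝ (Fin b)} {L : ℝ}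
    (hL : 0 ≤ L) (hA : ∀ x, ‖A x‖ ≤ L * ‖x‖) (l : Fin n) (x : EuclideanSpace ℝ (Fin (n * b))) :
    ‖blockOp l A x‖ ≤ L * ‖x‖ := by
  rw [blockOp_apply, norm_fromBlock]
  exact (hA _).trans (mul_le_mul_of_nonneg_left (norm_toBlock_le l x) hL)

/-- The vectors of `ℝ^{n b}` whose `l`-th block is supported on the first `t` coordinates. -/
def blockSubspace (b : ℕ) (l : Fin n) (t : ℕ) : Submodule ℝ (EuclideanSpace ℝ (Fin (n * b))) :=
  (initialSubspace b t).comap (toBlock b l : EuclideanSpace ℝ (Fin (n * b)) →ₗ[ℝ] _)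

lemma mem_blockSubspace {l : Fin n} {t : ℕ} {x : EuclideanSpace ℝ (Fin (n * b))} :
    x ∈ blockSubspace b l t ↔ toBlock b l x ∈ initialSubspace b t := Iff.rfl

lemma blockSubspace_mono (l : Fin n) : Monotone (blockSubspace b l) :=
  fun _ _ hst _ hx => initialSubspace_mono b hst hx

lemma diagonal_mem_blockSubspace (l : Fin n) (t : ℕ) (δ : Fin (n * b) → ℝ)
    (x : EuclideanSpace ℝ (Fin (n * b))) (hx : x ∈ blockSubspace b l t) :
    Matrix.toEuclideanLin (Matrix.diagonal δ) x ∈ blockSubspace b l t := by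
  intro i hi
  have h := hx i hi
  change toBlock b l _ i = 0
  change toBlock b l _ i = 0 at h
  rw [toBlock_apply] at h ⊢
  rw [toEuclideanLin_diagonal_apply, h, mul_zero]

lemma fromBlock_mem_blockSubspace {l l' : Fin n} {t : ℕ} {w : EuclideanSpace ℝ (Fin b)}
    (h : l' = l → w ∈ initialSubspace b t) : fromBlock b l' w ∈ blockSubspace b l t := by
  rw [mem_blockSubspace, toBlock_fromBlock]
  split_ifs with hl
  · exact h hl.symm
  · exact Submodule.zero_mem _

end Blocks

/-! ### Random even partitions and random samples -/

section Balanced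

variable {ι : Type*} [Fintype ι] [DecidableEq ι] {m : ℕ}

/-- The maps `ι → Fin m` all of whose fibres have `n` elements and that map `A` to `j`. -/
def balancedOn (n : ℕ) (j : Fin m) (A : Finset ι) : Finset (ι → Fin m) :=
  Finset.univ.filter fun σ => (∀ i, (Finset.univ.filter fun x => σ x = i).card = n) ∧
    ∀ x ∈ A, σ x = j

lemma mem_balancedOn {n : ℕ} {j : Fin m} {A : Finset ι} {σ : ι → Fin m} :
    σ ∈ balancedOn n j A ↔
      (∀ i, (Finset.univ.filter fun x => σ x = i).card = n) ∧ ∀ x ∈ A, σ x = j := by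
  simp [balancedOn]

/-- Composition with the transposition of `x` and `y` keeps the fibre sizes and fixes `A`. -/
lemma card_balancedOn_insert_le {n : ℕ} {j : Fin m} {A : Finset ι} {x y : ι} (hx : x ∉ A)
    (hy : y ∉ A) : (balancedOn n j (insert x A)).card ≤ (balancedOn n j (insert y A)).card := by
  refine Finset.card_le_card_of_injOn (fun σ => σ ∘ Equiv.swap x y) (fun σ hσ => ?_) ?_
  · rw [Finset.mem_coe, mem_balancedOn] at hσ ⊢
    refine ⟨fun i => ?_, fun z hz => ?_⟩
    · rw [← hσ.1 i]
      exact Finset.card_equiv (Equiv.swap x y) fun z => by simp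
    · rcases Finset.mem_insert.1 hz with rfl | hz
      · simpa using hσ.2 x (by simp)
      · have h1 : z ≠ x := fun h => hx (h ▸ hz)
        have h2 : z ≠ y := fun h => hy (h ▸ hz)
        simpa [Equiv.swap_apply_of_ne_of_ne h1 h2] using hσ.2 z (by simp [hz])
  · intro σ _ τ _ h
    ext z
    have := congrFun h (Equiv.swap x y z)
    simpa using congrArg Fin.val this

/-- Given that `A`, of size `a`, lies in part `j`, a further index falls there with probability `(n
- a) / (mn - a) ≤ 1 / m`. The proof counts the pairs `(y, σ)` with `y ∉ A` and `σ y = j` in two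
ways; by symmetry every `y` contributes equally. -/
lemma mul_card_balancedOn_insert_le {n : ℕ} (hι : Fintype.card ι = m * n) {j : Fin m}
    {A : Finset ι} {x : ι} (hx : x ∉ A) :
    m * (balancedOn n j (insert x A)).card ≤ (balancedOn n j A).card := by
  set a := A.card with ha
  have haN : a < m * n := by
    rw [← hι, ← Finset.card_univ]
    exact Finset.card_lt_card (Finset.ssubset_univ_iff.2 fun h => hx (h ▸ Finset.mem_univ x))
  have hsum : ∑ y ∈ Aᶜ, (balancedOn n j (insert y A)).card =
      ∑ σ ∈ balancedOn n j A, (Aᶜ.filter fun y => σ y = j).card := by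
    refine Eq.trans ?_ (Finset.sum_card_bipartiteAbove_eq_sum_card_bipartiteBelow
      (fun (y : ι) (σ : ι → Fin m) => σ y = j))
    refine Finset.sum_congr rfl fun y _ => congrArg Finset.card ?_
    ext σ
    simp only [Finset.bipartiteAbove, Finset.mem_filter, mem_balancedOn, Finset.forall_mem_insert]
    tauto
  have hL : ∑ y ∈ Aᶜ, (balancedOn n j (insert y A)).card =
      (m * n - a) * (balancedOn n j (insert x A)).card := by
    rw [Finset.sum_const_nat (m := (balancedOn n j (insert x A)).card), Finset.card_compl, hι]
    intro y hy
    rw [Finset.mem_compl] at hy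
    exact le_antisymm (card_balancedOn_insert_le hy hx) (card_balancedOn_insert_le hx hy)
  have hR : ∑ σ ∈ balancedOn n j A, (Aᶜ.filter fun y => σ y = j).card ≤
      ∑ σ ∈ balancedOn n j A, (n - a) := by
    refine Finset.sum_le_sum fun σ hσ => ?_
    rw [mem_balancedOn] at hσ
    rw [← hσ.1 j, ha, ← Finset.card_sdiff_of_subset]
    · refine Finset.card_le_card fun y hy => ?_
      simp only [Finset.mem_filter, Finset.mem_compl] at hy
      simp [hy.1, hy.2]
    · intro y hy
      simpa using hσ.2 y hy
  rw [← hsum, hL, Finset.sum_const, smul_eq_mul] at hR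
  refine le_of_mul_le_mul_left (a := m * n - a) ?_ (Nat.sub_pos_of_lt haN)
  have hm : 1 ≤ m := Nat.one_le_iff_ne_zero.2 fun h => by simp [h] at haN
  have h1 : m * (n - a) ≤ m * n - a := by
    rw [Nat.mul_sub]
    exact Nat.sub_le_sub_left (Nat.le_mul_of_pos_left a hm) _
  calc (m * n - a) * (m * (balancedOn n j (insert x A)).card)
      = m * ((m * n - a) * (balancedOn n j (insert x A)).card) := by ring
    _ ≤ m * ((balancedOn n j A).card * (n - a)) := Nat.mul_le_mul_left _ hR
    _ = m * (n - a) * (balancedOn n j A).card := by ring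
    _ ≤ _ := Nat.mul_le_mul_right _ h1

lemma pow_mul_card_balancedOn_le {n : ℕ} (hι : Fintype.card ι = m * n) (j : Fin m)
    (A : Finset ι) : m ^ A.card * (balancedOn n j A).card ≤ (balancedOn n j (∅ : Finset ι)).card := by
  induction A using Finset.induction_on with
  | empty => simp
  | insert x A hx ih =>
    rw [Finset.card_insert_of_notMem hx, pow_succ, mul_assoc]
    exact (Nat.mul_le_mul_left _ (mul_card_balancedOn_insert_le hι hx)).trans ih

lemma pow_card_filter_eq_prod {κ : Type*} (s : Finset κ) (p : κ → Prop) [DecidablePred p] (z : ℝ) :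
    (1 + z) ^ (s.filter p).card = ∏ i ∈ s, (1 + if p i then z else 0) := by
  rw [← Finset.prod_const, Finset.prod_filter]
  exact Finset.prod_congr rfl fun i _ => by split_ifs <;> simp

/-- The moment generating function of the number of elements of `B` in a part of a random even
partition is at most that of a binomial variable. -/
lemma sum_balancedOn_le {n : ℕ} (hι : Fintype.card ι = m * n) (j : Fin m) (B : Finset ι)
    {z : ℝ} (hz : 0 ≤ z) :
    ∑ σ ∈ balancedOn n j (∅ : Finset ι), (1 + z) ^ (B.filter fun i => σ i = j).card ≤
      (1 + z / m) ^ B.card * (balancedOn n j (∅ : Finset ι)).card := by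
  have hm : (0 : ℝ) < m := by exact_mod_cast j.pos
  -- Expanding the product over `B` into subsets `A` reduces the moment to the probabilities that
  -- `A` lies in part `j`. As `z ≥ 0`, the bound `m ^ (-|A|)` can be inserted term by term.
  have h1 : ∀ σ : ι → Fin m, (1 + z) ^ (B.filter fun i => σ i = j).card =
      ∑ A ∈ B.powerset, z ^ A.card * if ∀ i ∈ A, σ i = j then 1 else 0 := by
    intro σ
    rw [pow_card_filter_eq_prod, Finset.prod_one_add]
    refine Finset.sum_congr rfl fun A _ => ?_
    rw [Finset.prod_ite_zero, Finset.prod_const]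
    simp
  have h2 : ∀ A : Finset ι, ∑ σ ∈ balancedOn n j (∅ : Finset ι),
      (if ∀ i ∈ A, σ i = j then (1 : ℝ) else 0) = (balancedOn n j A).card := by
    intro A
    rw [Finset.sum_boole]
    congr 2
    ext σ
    simp [mem_balancedOn]
  simp_rw [h1]
  rw [Finset.sum_comm]
  simp_rw [← Finset.mul_sum, h2]
  have h3 : (1 + z / m) ^ B.card = ∑ A ∈ B.powerset, (z / m) ^ A.card := by
    rw [← Finset.prod_const, Finset.prod_one_add]
    simp only [Finset.prod_const]
  rw [h3, Finset.sum_mul]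
  refine Finset.sum_le_sum fun A _ => ?_
  rw [div_pow, div_mul_eq_mul_div, mul_div_assoc]
  refine mul_le_mul_of_nonneg_left ?_ (pow_nonneg hz _)
  rw [le_div_iff₀ (pow_pos hm _), mul_comm]
  exact_mod_cast pow_mul_card_balancedOn_le hι j A

/-- The draws of machine `j` are independent, so the sum factors into a power; the samples of the
other machines only contribute a constant factor. -/
lemma sum_samples_eq {m r : ℕ} (j : Fin m) (B : Finset ι) (z : ℝ) :
    (Fintype.card ι : ℝ) ^ r *
      ∑ R : Fin m → Fin r → ι, (1 + z) ^ (Finset.univ.filter fun t => R j t ∈ B).card =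
    (Fintype.card ι + z * B.card) ^ r * (Fintype.card (Fin m → Fin r → ι) : ℝ) := by
  have h1 : ∑ ρ : Fin r → ι, (1 + z) ^ (Finset.univ.filter fun t => ρ t ∈ B).card =
      (Fintype.card ι + z * B.card) ^ r := by
    simp_rw [pow_card_filter_eq_prod]
    rw [← Fintype.sum_pow (fun i : ι => 1 + if i ∈ B then z else 0)]
    simp [Finset.sum_add_distrib, mul_comm]
  rw [← Equiv.sum_comp (Equiv.funSplitAt j (Fin r → ι)).symm, Fintype.sum_prod_type,
    Fintype.card_congr (Equiv.funSplitAt j (Fin r → ι)), Fintype.card_prod, ← h1, Finset.mul_sum,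
    Finset.sum_mul]
  refine Finset.sum_congr rfl fun ρ _ => ?_
  simp [Equiv.funSplitAt, Equiv.piSplitAt]
  ring

end Balanced

/-- The indices of the `m` functions that act on block `l`. -/
def blockIndices (m : ℕ) {n : ℕ} (l : Fin n) : Finset (Fin (m * n)) :=
  Finset.univ.filter fun i => (finProdFinEquiv.symm i).2 = l

lemma mem_blockIndices {m n : ℕ} {l : Fin n} {i : Fin (m * n)} :
    i ∈ blockIndices m l ↔ (finProdFinEquiv.symm i).2 = l := by
  simp only [blockIndices, Finset.mem_filter, Finset.mem_univ, true_and]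

lemma card_blockIndices (m : ℕ) {n : ℕ} (l : Fin n) : (blockIndices m l).card = m := by
  refine Eq.trans (Eq.symm ?_) (Finset.card_fin m)
  refine Finset.card_bij (fun s _ => finProdFinEquiv (s, l)) (fun s _ => ?_) (fun s _ t _ h => ?_)
    fun i hi => ?_
  · rw [mem_blockIndices, Equiv.symm_apply_apply]
  · exact congrArg Prod.fst (finProdFinEquiv.injective h)
  · rw [mem_blockIndices] at hi
    refine ⟨(finProdFinEquiv.symm i).1, Finset.mem_univ _, ?_⟩
    rw [← hi, Prod.mk.eta, Equiv.apply_symm_apply]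

/-- The number of functions of block `l` held by machine `j`. -/
def blockCount {m n r : ℕ} (D : DataDistribution m n r) (j : Fin m) (l : Fin n) : ℕ :=
  ((localData D j).filter fun i => i ∈ blockIndices m l).card

lemma blockCount_eq {m n r : ℕ} (D : DataDistribution m n r) (j : Fin m) (l : Fin n) :
    blockCount D j l = ((blockIndices m l).filter fun i => D.1.1 i = j).card +
      (Finset.univ.filter fun t => D.2 j t ∈ blockIndices m l).card := by
  rw [blockCount, localData, Multiset.filter_add, Multiset.card_add, Multiset.filter_map,
    Multiset.card_map, ← Finset.filter_val, Finset.card_val, ← Finset.filter_val, Finset.card_val,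
    Finset.filter_filter]
  congr 2
  ext i
  simp [and_comm]

lemma sum_pow_blockCount_le {m n r : ℕ} (hn : 0 < n) (j : Fin m) (l : Fin n) {z : ℝ} (hz : 0 ≤ z) :
    ∑ D : DataDistribution m n r, (1 + z) ^ blockCount D j l ≤
      (1 + z / m) ^ m * (1 + z / n) ^ r * Fintype.card (DataDistribution m n r) := by
  have hm : 0 < m := j.pos
  have hm' : (0 : ℝ) < m := by exact_mod_cast hm
  have hn' : (0 : ℝ) < n := by exact_mod_cast hn
  have h1 := sum_balancedOn_le (n := n) (by simp) j (blockIndices m l) hz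
  have h2 := sum_samples_eq (r := r) j (blockIndices m l) z
  rw [card_blockIndices] at h1 h2
  set Y := ∑ R : Fin m → Fin r → Fin (m * n),
    (1 + z) ^ (Finset.univ.filter fun t => R j t ∈ blockIndices m l).card with hY
  have h3 : Y = (1 + z / n) ^ r * (Fintype.card (Fin m → Fin r → Fin (m * n)) : ℝ) := by
    have h0 : (0 : ℝ) < (Fintype.card (Fin (m * n)) : ℝ) ^ r := by
      rw [Fintype.card_fin]
      positivity
    refine mul_left_cancel₀ h0.ne' ?_
    rw [h2, ← mul_assoc, ← mul_pow, Fintype.card_fin]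
    congr 2
    push_cast
    field_simp
  have h4 : ∑ σ : {σ : Fin (m * n) → Fin m //
      ∀ j, (Finset.univ.filter fun i => σ i = j).card = n},
      (1 + z) ^ ((blockIndices m l).filter fun i => σ.1 i = j).card =
      ∑ σ ∈ balancedOn n j (∅ : Finset (Fin (m * n))),
        (1 + z) ^ ((blockIndices m l).filter fun i => σ i = j).card :=
    (Finset.sum_subtype _ (fun σ => by simp [mem_balancedOn]) fun σ : Fin (m * n) → Fin m =>
        (1 + z) ^ ((blockIndices m l).filter fun i => σ i = j).card).symm
  have h5 : (balancedOn n j (∅ : Finset (Fin (m * n)))).card = Fintype.card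
      {σ : Fin (m * n) → Fin m // ∀ j, (Finset.univ.filter fun i => σ i = j).card = n} := by
    rw [Fintype.card_subtype]
    congr 1
    ext σ
    simp [mem_balancedOn]
  rw [← h4, h5] at h1
  simp_rw [blockCount_eq, pow_add]
  rw [Fintype.sum_prod_type]
  simp only [← Finset.mul_sum]
  rw [← hY, ← Finset.sum_mul, h3, Fintype.card_prod]
  refine (mul_le_mul_of_nonneg_right h1 (by positivity)).trans (le_of_eq ?_)
  push_cast
  ring

/-- The distributions in which some machine holds at least `k` functions of block `l`. -/
def crowded {m n r : ℕ} (k : ℕ) (l : Fin n) : Finset (DataDistribution m n r) :=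
  Finset.univ.filter fun D => ∃ j, k ≤ blockCount D j l

/-- Markov's inequality for `exp (blockCount D j l)`, which corresponds to `1 + z = e`, followed by
a union bound over the machines. The partition contributes `e^z` to the moment and the samples at
most `e^(α z)`. -/
lemma card_crowded_le {m n r : ℕ} {α : ℝ} (hr : (r : ℝ) ≤ α * n) (hn : 0 < n) (k : ℕ) (l : Fin n) :
    ((crowded k l : Finset (DataDistribution m n r)).card : ℝ) ≤
      m * Real.exp ((1 + α) * (Real.exp 1 - 1) - k) * Fintype.card (DataDistribution m n r) := by
  have hn' : (0 : ℝ) < n := by exact_mod_cast hn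
  set z := Real.exp 1 - 1 with hzdef
  have hz : 0 ≤ z := by
    have := Real.add_one_le_exp (1 : ℝ)
    linarith
  have hj : ∀ j : Fin m, ((Finset.univ.filter fun D : DataDistribution m n r =>
      k ≤ blockCount D j l).card : ℝ) ≤
      Real.exp ((1 + α) * z - k) * Fintype.card (DataDistribution m n r) := by
    intro j
    have hm' : (0 : ℝ) < m := by exact_mod_cast j.pos
    have h1 := sum_pow_blockCount_le (r := r) hn j l hz
    have h2 : ((Finset.univ.filter fun D : DataDistribution m n r =>
        k ≤ blockCount D j l).card : ℝ) * (1 + z) ^ k ≤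
        ∑ D : DataDistribution m n r, (1 + z) ^ blockCount D j l := by
      rw [← nsmul_eq_mul]
      refine (Finset.card_nsmul_le_sum _ _ _ fun D hD => ?_).trans
        (Finset.sum_le_sum_of_subset_of_nonneg (Finset.filter_subset _ _) fun D _ _ => by positivity)
      exact pow_le_pow_right₀ (by linarith) (Finset.mem_filter.1 hD).2
    have h3 : (1 + z) ^ k = Real.exp k := by
      rw [hzdef, add_sub_cancel, ← Real.exp_nat_mul, mul_one]
    have h4 : (1 + z / m) ^ m ≤ Real.exp z := by
      have h := Real.add_one_le_exp (z / m)
      calc (1 + z / m) ^ m ≤ Real.exp (z / m) ^ m := by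
            gcongr
            linarith
        _ = Real.exp z := by
          rw [← Real.exp_nat_mul, mul_div_cancel₀ _ hm'.ne']
    have h5 : (1 + z / n) ^ r ≤ Real.exp (α * z) := by
      have h := Real.add_one_le_exp (z / n)
      calc (1 + z / n) ^ r ≤ Real.exp (z / n) ^ r := by
            gcongr
            linarith
        _ = Real.exp (r * (z / n)) := by rw [← Real.exp_nat_mul]
        _ ≤ Real.exp (α * z) := by
          refine Real.exp_le_exp.2 ?_
          calc (r : ℝ) * (z / n) ≤ α * n * (z / n) := by gcongr
            _ = α * z := by field_simp
    have h6 : (1 + z / m) ^ m * (1 + z / n) ^ r ≤ Real.exp ((1 + α) * z) := by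
      rw [one_add_mul, Real.exp_add]
      gcongr
    rw [Real.exp_sub, div_mul_eq_mul_div, le_div_iff₀ (Real.exp_pos _), ← h3]
    exact h2.trans (h1.trans (mul_le_mul_of_nonneg_right h6 (Nat.cast_nonneg _)))
  have hsub : (crowded k l : Finset (DataDistribution m n r)) ⊆ Finset.univ.biUnion fun j =>
      Finset.univ.filter fun D : DataDistribution m n r => k ≤ blockCount D j l := by
    intro D hD
    simpa [crowded] using hD
  calc ((crowded k l : Finset (DataDistribution m n r)).card : ℝ)
      ≤ ∑ j : Fin m, ((Finset.univ.filter fun D : DataDistribution m n r =>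
          k ≤ blockCount D j l).card : ℝ) := by
        exact_mod_cast (Finset.card_le_card hsub).trans Finset.card_biUnion_le
    _ ≤ ∑ _j : Fin m, Real.exp ((1 + α) * z - k) * Fintype.card (DataDistribution m n r) :=
        Finset.sum_le_sum fun j _ => hj j
    _ = _ := by
        rw [Finset.sum_const, Finset.card_fin, nsmul_eq_mul, mul_assoc]

/-! ### Expectations over the data distribution -/

/-- The expectation of a function of the data is its average. -/
lemma Algorithm.lintegral_data {m n : ℕ} {α : ℝ} (A : Algorithm.{u} m n α)
    (φ : DataDistribution m n ⌊α * (n : ℝ)⌋₊ → ENNReal) :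
    ∫⁻ ω, φ (A.data ω) ∂A.P =
      (∑ D, φ D) / Fintype.card (DataDistribution m n ⌊α * (n : ℝ)⌋₊) := by
  let _ : MeasurableSpace (DataDistribution m n ⌊α * (n : ℝ)⌋₊) := ⊤
  have hmeas : Measurable A.data := measurable_to_countable' A.measurableSet_data
  rw [← lintegral_map (f := φ) measurable_from_top hmeas, lintegral_fintype]
  simp_rw [Measure.map_apply hmeas (measurableSet_singleton _), A.data_uniform]
  rw [← Finset.sum_mul, div_eq_mul_inv]

/-! ### Numerical estimates -/

section Numerics

variable {α : ℝ}

/-- The constant `e + max {1, α}`. -/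
def loadConst (α : ℝ) : ℝ := Real.exp 1 + max 1 α

lemma loadConst_ge (α : ℝ) : 3.7 ≤ loadConst α := by
  have h1 := Real.exp_one_gt_d9
  have h2 := le_max_left 1 α
  rw [loadConst]
  linarith

lemma two_mul_log_loadConst_le {m : ℝ} (hm : machineThreshold α ≤ m) :
    2 * Real.log (loadConst α) ≤ Real.log m := by
  have h0 := loadConst_ge α
  have h : loadConst α ^ 2 ≤ m := (le_max_right _ _).trans hm
  have := Real.log_le_log (by positivity) h
  rwa [Real.log_pow] at this

lemma one_le_log_loadConst (α : ℝ) : 1 ≤ Real.log (loadConst α) := by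
  have h0 := loadConst_ge α
  rw [Real.le_log_iff_exp_le (by linarith)]
  linarith [Real.exp_one_lt_d9]

lemma two_le_log {m : ℝ} (hm : machineThreshold α ≤ m) : 2 ≤ Real.log m := by
  have h1 := two_mul_log_loadConst_le hm
  have h2 := one_le_log_loadConst α
  linarith

/-- This is the logarithmic form of the bound on the crowding probability, and the place where the
exponential part of the threshold matters: it gives `log m ≥ 20 α` for `α ≤ 1` and helps to give
`log m ≥ 3` for `α ≥ 1`. -/
lemma exponent_nonpos (hα : 0 ≤ α) {m : ℝ} (hm : machineThreshold α ≤ m) :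
    Real.log m + ((1 + α) * (Real.exp 1 - 1) - loadConst α * Real.log m) +
      Real.log (Real.exp 1 + Real.exp α) + 2 * Real.log (loadConst α) ≤ 0 := by
  set ℓ := Real.log m with hℓ
  have hC := two_mul_log_loadConst_le hm
  have hC1 := one_le_log_loadConst α
  have e1 := Real.exp_one_gt_d9
  have e2 := Real.exp_one_lt_d9
  have hexp3 : Real.exp 3 = Real.exp 1 ^ 3 := by rw [← Real.exp_nat_mul]; norm_num
  have hthr : α / max 1 α * Real.exp (2 / max 1 α + 1) ≤ ℓ := by
    have h : Real.exp _ ≤ m := (le_max_left _ _).trans hm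
    exact (Real.le_log_iff_exp_le ((Real.exp_pos _).trans_le h)).2 h
  rw [← hℓ] at hC
  rcases le_total α 1 with h1 | h1
  · have hCe : loadConst α = Real.exp 1 + 1 := by rw [loadConst, max_eq_left h1]
    rw [max_eq_left h1, div_one, div_one, show (2 : ℝ) + 1 = 3 by norm_num, hexp3] at hthr
    have h20 : 20 ≤ Real.exp 1 ^ 3 := by
      calc (20 : ℝ) ≤ 2.7182818283 ^ 3 := by norm_num
        _ ≤ _ := by gcongr
    have h3 : α * 20 ≤ ℓ := (mul_le_mul_of_nonneg_left h20 hα).trans hthr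
    have h4 : Real.log (Real.exp 1 + Real.exp α) ≤ α + Real.log (loadConst α) := by
      rw [hCe]
      nth_rewrite 2 [← Real.log_exp α]
      rw [← Real.log_mul (Real.exp_pos _).ne' (by positivity)]
      refine Real.log_le_log (by positivity) ?_
      have := Real.one_le_exp hα
      nlinarith
    have h5 : loadConst α * ℓ = Real.exp 1 * ℓ + ℓ := by rw [hCe]; ring
    have h6 : 2.7182818283 * ℓ ≤ Real.exp 1 * ℓ := by
      refine mul_le_mul_of_nonneg_right e1.le (by linarith)
    have h7 : α * Real.exp 1 ≤ α * 2.7182818286 := mul_le_mul_of_nonneg_left e2.le hα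
    nlinarith
  · have hCe : loadConst α = Real.exp 1 + α := by rw [loadConst, max_eq_right h1]
    rw [max_eq_right h1, div_self (by linarith), one_mul] at hthr
    have h3 : 3 ≤ ℓ := by
      -- Up to `α = 2` the exponential part of the threshold suffices; beyond, the quadratic part
      -- does, because `(e + 2)² > e³`.
      rcases le_total α 2 with h2 | h2
      · have h4 : 1 ≤ 2 / α := by rw [le_div_iff₀ (by linarith)]; linarith
        have := Real.add_one_le_exp (2 / α + 1)
        linarith
      · refine le_trans ?_ hC
        have hpow : 2 * Real.log (Real.exp 1 + α) = Real.log ((Real.exp 1 + α) ^ 2) := by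
          rw [Real.log_pow]
          norm_num
        rw [hCe, hpow, Real.le_log_iff_exp_le (by positivity), hexp3]
        calc Real.exp 1 ^ 3 ≤ 2.7182818286 ^ 3 := by gcongr
          _ ≤ (2.7182818283 + 2) ^ 2 := by norm_num
          _ ≤ _ := by gcongr
    have h4 : Real.log (Real.exp 1 + Real.exp α) ≤ α + Real.log 2 := by
      nth_rewrite 2 [← Real.log_exp α]
      rw [← Real.log_mul (Real.exp_pos _).ne' (by norm_num)]
      refine Real.log_le_log (by positivity) ?_
      have := Real.exp_le_exp.2 h1
      linarith
    have h5 := Real.log_two_lt_d9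
    have h6 : 3 * (Real.exp 1 + α - 2) ≤ ℓ * (Real.exp 1 + α - 2) :=
      mul_le_mul_of_nonneg_right h3 (by linarith)
    rw [hCe] at hC ⊢
    nlinarith

lemma crowding_bound (hα : 0 ≤ α) {m : ℝ} (hm : machineThreshold α ≤ m) {k : ℝ}
    (hk : loadConst α * Real.log m ≤ k) :
    m * Real.exp ((1 + α) * (Real.exp 1 - 1) - k) ≤ 1 - probConst α := by
  have hC := loadConst_ge α
  have hm0 : 0 < m := lt_of_lt_of_le (Real.exp_pos _) ((le_max_left _ _).trans hm)
  have h := exponent_nonpos hα hm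
  have hq : 1 - probConst α =
      Real.exp (-(Real.log (Real.exp 1 + Real.exp α) + 2 * Real.log (loadConst α))) := by
    rw [probConst, sub_sub_cancel, Real.exp_neg, Real.exp_add, Real.exp_log (by positivity),
      one_div, mul_comm 2, Real.exp_mul, Real.exp_log (by linarith)]
    norm_cast
  rw [hq]
  nth_rewrite 1 [← Real.exp_log hm0]
  rw [← Real.exp_add, Real.exp_le_exp]
  linarith

lemma probConst_pos (α : ℝ) : 0 < probConst α := by
  have h1 := loadConst_ge α
  have h2 := Real.exp_one_gt_d9
  have h3 := Real.exp_pos α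
  rw [probConst, sub_pos, ← loadConst]
  rw [div_lt_one (by positivity)]
  nlinarith

lemma probConst_lt_one (α : ℝ) : probConst α < 1 := by
  have h1 := loadConst_ge α
  rw [probConst, ← loadConst]
  have : 0 < 1 / ((Real.exp 1 + Real.exp α) * loadConst α ^ 2) := by positivity
  linarith

/-- Room for the `k = ⌈T⌉` classes among `m` functions. With `y = √m`, the left side is at most `y ·
2 y / e + 1`, by `loadConst α ≤ y` and `log y ≤ y / e`. -/
lemma loadConst_mul_log_add_one_le {m : ℝ} (hm : machineThreshold α ≤ m) :
    loadConst α * Real.log m + 1 ≤ m := by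
  have hC := loadConst_ge α
  have hCm : loadConst α ^ 2 ≤ m := (le_max_right _ _).trans hm
  have hm0 : 0 < m := lt_of_lt_of_le (by positivity) hCm
  set y := Real.sqrt m with hy
  have hy2 : y ^ 2 = m := Real.sq_sqrt hm0.le
  have hCy : loadConst α ≤ y := Real.le_sqrt_of_sq_le hCm
  have hlog : Real.log m = 2 * Real.log y := by rw [← hy2, Real.log_pow]; norm_num
  have e1 := Real.exp_one_gt_d9
  have h1 : Real.log y ≤ y / Real.exp 1 := by
    have h := Real.log_le_sub_one_of_pos (x := y / Real.exp 1) (by positivity)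
    rw [Real.log_div (by linarith) (Real.exp_pos _).ne', Real.log_exp] at h
    linarith
  have h2 : y / Real.exp 1 ≤ y / 2.7 :=
    div_le_div_of_nonneg_left (by linarith) (by norm_num) (by linarith)
  have h3 : 0 ≤ Real.log y := Real.log_nonneg (by linarith)
  calc loadConst α * Real.log m + 1 ≤ y * (2 * (y / 2.7)) + 1 := by
        rw [hlog]
        gcongr
        exact h1.trans h2
    _ ≤ y ^ 2 := by
        have : (3.7 : ℝ) ^ 2 ≤ y ^ 2 := by gcongr; linarith
        have h4 : y * (2 * (y / 2.7)) = y ^ 2 * (20 / 27) := by ring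
        rw [h4]
        norm_num at this
        linarith
    _ = m := hy2

end Numerics

/-- The decay rate of the minimizer of the chain. -/
lemma exists_decay {s : ℝ} (hs : 0 < s) :
    ∃ θ : ℝ, 0 < θ ∧ θ < 1 ∧ (1 - θ) ^ 2 = s * θ ∧ -Real.log θ ≤ Real.sqrt s := by
  -- With `θ = e^(-2v)` the equation reads `(2 sinh v)² = s`, and `v ≤ sinh v` bounds `-log θ = 2v`.
  set v := Real.arsinh (Real.sqrt s / 2) with hv
  have hs' : 0 < Real.sqrt s := Real.sqrt_pos.2 hs
  have hv0 : 0 < v := Real.arsinh_pos_iff.2 (by positivity)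
  have hsinh : Real.sinh v = Real.sqrt s / 2 := Real.sinh_arsinh _
  refine ⟨Real.exp (-(2 * v)), Real.exp_pos _, ?_, ?_, ?_⟩
  · rw [Real.exp_lt_one_iff]
    linarith
  · have h1 : (2 * Real.sinh v) ^ 2 = s := by
      rw [hsinh, mul_div_cancel₀ _ two_ne_zero, Real.sq_sqrt hs.le]
    have h2 : Real.exp (-(2 * v)) = Real.exp (-v) ^ 2 := by
      rw [← Real.exp_nat_mul]
      congr 1
      push_cast
      ring
    have h3 : Real.exp v * Real.exp (-v) = 1 := by rw [← Real.exp_add]; simp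
    rw [← h1, h2, Real.sinh_eq]
    linear_combination (-(1 + Real.exp v * Real.exp (-v)) + 2 * Real.exp (-v) ^ 2) * h3
  · rw [Real.log_exp, neg_neg]
    have : v ≤ Real.sinh v := Real.self_le_sinh_iff.2 hv0.le
    linarith

/-- Here `K` is the advance per round and `u = -log θ`. The power `3/2` arises as one factor `T`
from the advance and `√T` from the decay rate; the constant `4 √2` is `2 √8`. -/
lemma decay_rounds_le {T K Γ u Λ : ℝ} {H : ℝ} (hT : 0 < T) (hK : 0 ≤ K) (hKT : K ≤ T) (hΓ : 0 < Γ)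
    (hH0 : 0 ≤ H) (hu : u ≤ Real.sqrt (8 * T / Γ)) (hΛ : 0 ≤ Λ)
    (hH : H ≤ Real.sqrt Γ / (4 * Real.sqrt 2 * T ^ (3 / 2 : ℝ)) * Λ) :
    2 * H * K * u ≤ Λ := by
  have hT32 : T ^ (3 / 2 : ℝ) = T * Real.sqrt T := by
    rw [Real.sqrt_eq_rpow, ← Real.rpow_one_add' hT.le (by norm_num)]
    norm_num
  have h8 : Real.sqrt (8 * T / Γ) = 2 * Real.sqrt 2 * Real.sqrt T / Real.sqrt Γ := by
    rw [Real.sqrt_div (by positivity), Real.sqrt_mul (by norm_num), show (8 : ℝ) = 2 ^ 2 * 2 by norm_num,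
      Real.sqrt_mul (by norm_num), Real.sqrt_sq (by norm_num)]
  have hsT : 0 < Real.sqrt T := Real.sqrt_pos.2 hT
  have hsΓ : 0 < Real.sqrt Γ := Real.sqrt_pos.2 hΓ
  rw [hT32] at hH
  calc 2 * H * K * u ≤ 2 * H * K * Real.sqrt (8 * T / Γ) := by gcongr
    _ ≤ 2 * (Real.sqrt Γ / (4 * Real.sqrt 2 * (T * Real.sqrt T)) * Λ) * T *
        Real.sqrt (8 * T / Γ) := by gcongr
    _ = Λ := by
      rw [h8]
      field_simp
      norm_num

/-! ### The order of the bound -/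

/-- The margin `δ` is used twice: it makes `κ / n - 1` comparable to `κ / n`, and it keeps the
logarithm in the bound above `log (1 + δ)`, so that the additive constant `log (4 / probConst α)`
can be absorbed. -/
lemma roundsBound_order {α : ℝ} {δ : ℝ} (hδ : 0 < δ) :
    ∃ c : ℝ, 0 < c ∧
      ∀ (m n : ℕ) (L μ ε r : ℝ), 1 ≤ n → 0 < μ → (1 + δ) * (n : ℝ) ≤ L / μ →
        machineThreshold α ≤ (m : ℝ) → 0 < ε → 0 < r →
        (1 + δ) * (4 * ε) ≤ probConst α * (μ * (n : ℝ) * r ^ 2) →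
        c * Real.sqrt (L / μ / ((n : ℝ) * Real.log (m : ℝ) ^ 3)) *
            Real.log (μ * (n : ℝ) * r ^ 2 / ε) ≤
          roundsBound α m n L μ ε r := by
  have hC := loadConst_ge α
  have hp := probConst_pos α
  have hp1 := probConst_lt_one α
  have hlδ : 0 < Real.log (1 + δ) := Real.log_pos (by linarith)
  set g := Real.log (4 / probConst α) with hg
  have hg0 : 0 < g := Real.log_pos (by rw [lt_div_iff₀ hp]; linarith)
  set c1 := 4 * Real.sqrt 2 * loadConst α ^ (3 / 2 : ℝ) with hc1
  have hc1' : 0 < c1 := by positivity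
  refine ⟨Real.sqrt (δ / (1 + δ)) / c1 / (1 + g / Real.log (1 + δ)), by positivity, ?_⟩
  intro m n L μ ε r hn hμ hκ hm hε hr hεr
  have hn' : (0 : ℝ) < n := by exact_mod_cast hn
  have hℓ := two_le_log hm
  set ℓ := Real.log (m : ℝ) with hℓdef
  set κ := L / μ / n with hκdef
  have hκ' : 1 + δ ≤ κ := by rw [hκdef, le_div_iff₀ hn']; exact hκ
  have hY : 0 < μ * n * r ^ 2 / ε := by positivity
  set Y := μ * n * r ^ 2 / ε with hYdef
  have hZ : probConst α * (μ * n * r ^ 2 / (4 * ε)) = Y * (probConst α / 4) := by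
    rw [hYdef]; field_simp
  have hZδ : 1 + δ ≤ Y * (probConst α / 4) := by
    rw [← hZ, ← mul_div_assoc, le_div_iff₀ (by positivity)]
    exact hεr
  set Z := Y * (probConst α / 4) with hZdef
  have hlogZ : Real.log (1 + δ) ≤ Real.log Z := Real.log_le_log (by linarith) hZδ
  have hYZ : Real.log Y = Real.log Z + g := by
    rw [hZdef, hg, ← Real.log_mul (by positivity) (by positivity)]
    congr 1
    field_simp
  have hlogY : Real.log Y ≤ (1 + g / Real.log (1 + δ)) * Real.log Z := by
    have : g ≤ g / Real.log (1 + δ) * Real.log Z := by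
      rw [div_mul_eq_mul_div, le_div_iff₀ hlδ]
      exact mul_le_mul_of_nonneg_left hlogZ hg0.le
    rw [hYZ]
    linarith
  have hsq : Real.sqrt (δ / (1 + δ)) * Real.sqrt κ ≤ Real.sqrt (κ - 1) := by
    rw [← Real.sqrt_mul (by positivity)]
    refine Real.sqrt_le_sqrt ?_
    rw [div_mul_eq_mul_div, div_le_iff₀ (by linarith)]
    nlinarith
  have hℓ32 : Real.sqrt (ℓ ^ 3) = ℓ ^ (3 / 2 : ℝ) := by
    rw [Real.sqrt_eq_rpow, ← Real.rpow_natCast, ← Real.rpow_mul (by linarith)]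
    norm_num
  have hκℓ : Real.sqrt (L / μ / (n * ℓ ^ 3)) = Real.sqrt κ / ℓ ^ (3 / 2 : ℝ) := by
    rw [← hℓ32, ← Real.sqrt_div (by linarith), ← div_div]
  have hR : roundsBound α m n L μ ε r =
      Real.sqrt (κ - 1) / (c1 * ℓ ^ (3 / 2 : ℝ)) * Real.log Z := by
    rw [roundsBound, hZ, ← loadConst, Real.mul_rpow (by linarith) (by linarith), hc1, ← hκdef,
      mul_assoc (4 * Real.sqrt 2)]
  have hG : 0 < 1 + g / Real.log (1 + δ) := by positivity
  have hlogZ0 : 0 < Real.log Z := hlδ.trans_le hlogZ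
  rw [hR, hκℓ]
  calc Real.sqrt (δ / (1 + δ)) / c1 / (1 + g / Real.log (1 + δ)) *
        (Real.sqrt κ / ℓ ^ (3 / 2 : ℝ)) * Real.log Y
      ≤ Real.sqrt (δ / (1 + δ)) / c1 / (1 + g / Real.log (1 + δ)) *
        (Real.sqrt κ / ℓ ^ (3 / 2 : ℝ)) * ((1 + g / Real.log (1 + δ)) * Real.log Z) := by
        gcongr
    _ = Real.sqrt (δ / (1 + δ)) * Real.sqrt κ / (c1 * ℓ ^ (3 / 2 : ℝ)) * Real.log Z := by
        have : 0 < ℓ ^ (3 / 2 : ℝ) := by positivity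
        field_simp
    _ ≤ _ := by gcongr

/-! ### Functions of one block -/

section BlockFamily

variable {m n b : ℕ}

/-- The operators of the family that acts on each of the `n` blocks by the same `m` operators. -/
def familyOp (A : Fin m → EuclideanSpace ℝ (Fin b) →L[ℝ] EuclideanSpace ℝ (Fin b))
    (i : Fin (m * n)) : EuclideanSpace ℝ (Fin (n * b)) →L[ℝ] EuclideanSpace ℝ (Fin (n * b)) :=
  blockOp (finProdFinEquiv.symm i).2 (A (finProdFinEquiv.symm i).1)

/-- The linear terms of the family that acts on each of the `n` blocks by the same `m` functions. -/
def familyVec (c : Fin m → EuclideanSpace ℝ (Fin b)) (i : Fin (m * n)) :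
    EuclideanSpace ℝ (Fin (n * b)) :=
  fromBlock b (finProdFinEquiv.symm i).2 (c (finProdFinEquiv.symm i).1)

variable {A : Fin m → EuclideanSpace ℝ (Fin b) →L[ℝ] EuclideanSpace ℝ (Fin b)}
  {c : Fin m → EuclideanSpace ℝ (Fin b)} {w : EuclideanSpace ℝ (Fin b)} {L μ : ℝ}

lemma isSymmPos_familyOp (hA : ∀ s, IsSymmPos (A s)) (i : Fin (m * n)) :
    IsSymmPos (familyOp A i) :=
  (hA _).blockOp _

/-- Only `m` of the `m * n` functions act on a given block, so each must have modulus `n μ` there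
for the average to have modulus `μ`. This is why `κ / n` replaces `κ`. -/
lemma le_sum_inner_familyOp (hμ : ∀ s x, n * μ * ‖x‖ ^ 2 ≤ inner ℝ (A s x) x)
    (x : EuclideanSpace ℝ (Fin (n * b))) :
    (m * n : ℝ) * μ * ‖x‖ ^ 2 ≤ ∑ i, inner ℝ (familyOp A i x) x := by
  rw [← Equiv.sum_comp finProdFinEquiv, Fintype.sum_prod_type]
  simp only [familyOp, Equiv.symm_apply_apply, inner_blockOp]
  calc (m * n : ℝ) * μ * ‖x‖ ^ 2 = ∑ _s : Fin m, ∑ l : Fin n, n * μ * ‖toBlock b l x‖ ^ 2 := by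
        rw [← Finset.mul_sum, ← norm_sq_eq_sum_toBlock]
        simp only [Finset.sum_const, Finset.card_univ, Fintype.card_fin, nsmul_eq_mul]
        ring
    _ ≤ _ := Finset.sum_le_sum fun s _ => Finset.sum_le_sum fun l _ => hμ s _

lemma isInstance_family (hA : ∀ s, IsSymmPos (A s)) (hL : ∀ s x, ‖A s x‖ ≤ L * ‖x‖) (hL0 : 0 ≤ L)
    (hμ : ∀ s x, n * μ * ‖x‖ ^ 2 ≤ inner ℝ (A s x) x) (hm : 0 < m) (hn : 0 < n) :
    IsInstance L μ fun i : Fin (m * n) => quadratic (familyOp A i) (familyVec c i) :=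
  isInstance_quadratic _ (isSymmPos_familyOp hA) (fun _ x => norm_blockOp_le hL0 (hL _) _ x) hm hn
    (le_sum_inner_familyOp hμ)

lemma sum_familyVec (c : Fin m → EuclideanSpace ℝ (Fin b)) (l : Fin n) :
    toBlock b l (∑ i, familyVec c i) = ∑ s, c s := by
  rw [map_sum, ← Equiv.sum_comp finProdFinEquiv, Fintype.sum_prod_type]
  simp [familyVec, toBlock_fromBlock, -finProdFinEquiv_symm_apply]

lemma sum_familyOp_copies (hw : ∑ s, A s w = ∑ s, c s) :
    ∑ i : Fin (m * n), familyOp A i (copies n w) = ∑ i, familyVec c i := by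
  have : ∀ i : Fin (m * n), familyOp A i (copies n w) = familyVec (fun s => A s w) i := fun i => by
    rw [familyOp, blockOp_apply, toBlock_copies, familyVec]
  simp_rw [this]
  exact ext_toBlock fun l => by rw [sum_familyVec, sum_familyVec, hw]

lemma le_average_family_sub (hA : ∀ s, IsSymmPos (A s))
    (hμ : ∀ s x, n * μ * ‖x‖ ^ 2 ≤ inner ℝ (A s x) x) (hw : ∑ s, A s w = ∑ s, c s)
    (hm : 0 < m) (hn : 0 < n) (x : EuclideanSpace ℝ (Fin (n * b))) :
    μ / 2 * ∑ l, ‖toBlock b l x - w‖ ^ 2 ≤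
      average (fun i : Fin (m * n) => quadratic (familyOp A i) (familyVec c i)) x -
      average (fun i : Fin (m * n) => quadratic (familyOp A i) (familyVec c i)) (copies n w) := by
  have hN : (0 : ℝ) < m * n := by positivity
  rw [average_quadratic_sub (isSymmPos_familyOp hA) (sum_familyOp_copies hw)]
  have h := le_sum_inner_familyOp hμ (x - copies n w)
  rw [norm_sq_eq_sum_toBlock] at h
  simp only [map_sub, toBlock_copies] at h
  rw [one_div, ← div_eq_inv_mul, le_div_iff₀ hN]
  simp only [map_sub]
  linarith

lemma average_family_le (hA : ∀ s, IsSymmPos (A s))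
    (hμ : ∀ s x, n * μ * ‖x‖ ^ 2 ≤ inner ℝ (A s x) x) (hμ0 : 0 < μ)
    (hw : ∑ s, A s w = ∑ s, c s) (hm : 0 < m) (hn : 0 < n) (x : EuclideanSpace ℝ (Fin (n * b))) :
    average (fun i : Fin (m * n) => quadratic (familyOp A i) (familyVec c i)) (copies n w) ≤
      average (fun i : Fin (m * n) => quadratic (familyOp A i) (familyVec c i)) x := by
  have h := le_average_family_sub hA hμ hw hm hn x
  have : 0 ≤ μ / 2 * ∑ l, ‖toBlock b l x - w‖ ^ 2 := by positivity
  linarith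

end BlockFamily

/-- A problem without hard features, for the case where the bound is vacuous. -/
lemma exists_instance {m n : ℕ} {L μ : ℝ} (hm : 0 < m) (hn : 0 < n) (hμ : 0 < μ)
    (hκ : (n : ℝ) ≤ L / μ) {r : ℝ} (hr : 0 < r) :
    ∃ (b : ℕ) (f : Fin (m * n) → EuclideanSpace ℝ (Fin (n * b)) → ℝ)
      (w : EuclideanSpace ℝ (Fin b)), IsInstance L μ f ∧ ‖w‖ = r ∧
        ∀ x, average f (copies n w) ≤ average f x := by
  have hL : n * μ ≤ L := (le_div_iff₀ hμ).1 hκ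
  have hν : 0 ≤ n * μ := by positivity
  let A : Fin m → EuclideanSpace ℝ (Fin 1) →L[ℝ] EuclideanSpace ℝ (Fin 1) :=
    fun _ => (n * μ) • ContinuousLinearMap.id ℝ _
  let w : EuclideanSpace ℝ (Fin 1) := EuclideanSpace.single 0 r
  have hA : ∀ s, IsSymmPos (A s) := fun s => isSymmPos_id.smul hν
  have hAμ : ∀ s x, n * μ * ‖x‖ ^ 2 ≤ inner ℝ (A s x) x := fun s x => by
    simp [A, real_inner_smul_left]
  refine ⟨1, fun i => quadratic (familyOp A i) (familyVec (fun s => A s w) i), w,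
    isInstance_family hA (fun s x => ?_) (hν.trans hL) hAμ hm hn, ?_,
    average_family_le hA hAμ hμ rfl hm hn⟩
  · simp only [A, smul_apply, ContinuousLinearMap.id_apply, norm_smul, Real.norm_of_nonneg hν]
    exact mul_le_mul_of_nonneg_right hL (norm_nonneg _)
  · simp [w, abs_of_pos hr]

/-! ### The hard family -/

section HardFamily

variable {m n b k : ℕ}

/-- The operators of the hard functions: the `s`-th one, for `s < k q`, has the edges of class
`s % k`. -/
def hardOp (m b : ℕ) (hk : 2 ≤ k) (q : ℕ) (ν a β : ℝ) (s : Fin m) :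
    EuclideanSpace ℝ (Fin b) →L[ℝ] EuclideanSpace ℝ (Fin b) :=
  chainOp b hk ν (if s.val < k * q then a else 0) β (s.val % k)

/-- The linear terms of the hard functions. -/
def hardVec (m b k q : ℕ) (c₀ : ℝ) (s : Fin m) : EuclideanSpace ℝ (Fin b) :=
  WithLp.toLp 2 fun i => if s.val < k * q ∧ s.val % k = 0 then (if i.val = 0 then c₀ else 0) else 0

/-- The first `k q` indices form `q` full periods; the cut-off there makes all edges of the path
equally heavy. -/
lemma sum_class_eq {q : ℕ} (hk : 2 ≤ k) (hq : k * q ≤ m) (v : ℕ) :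
    ∑ s : Fin m, (if s.val < k * q ∧ v % k = s.val % k then (1 : ℝ) else 0) = q := by
  rw [Fin.sum_univ_eq_sum_range fun s => if s < k * q ∧ v % k = s % k then (1 : ℝ) else 0,
    Finset.sum_boole]
  have h1 : (Finset.range m).filter (fun s => s < k * q ∧ v % k = s % k) =
      (Finset.range (k * q)).filter (fun s => s ≡ v [MOD k]) := by
    ext s
    rw [Finset.mem_filter, Finset.mem_filter, Finset.mem_range, Finset.mem_range, Nat.ModEq]
    constructor
    · rintro ⟨_, h, h'⟩
      exact ⟨h, h'.symm⟩
    · rintro ⟨h, h'⟩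
      exact ⟨h.trans_le hq, h, h'.symm⟩
  rw [h1, ← Nat.count_eq_card_filter_range, Nat.count_modEq_card _ (by omega)]
  simp [Nat.mul_div_cancel_left q (by omega : 0 < k)]

/-- The geometric sequence `w i = ρ θ ^ i` solves the stationarity equations. -/
lemma sum_hardOp_geometric (hk : 2 ≤ k) {q : ℕ} (hq0 : 0 < q) (hq : k * q ≤ m) {ν a β θ ρ : ℝ}
    (hβ : m * β = a * q * (1 - θ)) (hs : m * ν * θ = a * q * (1 - θ) ^ 2) :
    ∑ s, hardOp m b hk q ν a β s (WithLp.toLp 2 fun j : Fin b => ρ * θ ^ (j : ℕ)) =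
      ∑ s, hardVec m b k q ((m * ν + a * q * (1 - θ)) * ρ / q) s := by
  have hq' : (q : ℝ) ≠ 0 := by positivity
  ext i
  simp only [WithLp.ofLp_sum, Finset.sum_apply, hardOp, hardVec]
  simp_rw [chainOp_apply (fun j => ρ * θ ^ j)]
  have hsplit : ∀ (s : Fin m) (X Y : ℝ), (if s.val < k * q then a else 0) *
      ((if i.val % k = s.val % k then X else 0) + (if (i.val + 1) % k = s.val % k then Y else 0)) =
      a * X * (if s.val < k * q ∧ i.val % k = s.val % k then 1 else 0) +
      a * Y * (if s.val < k * q ∧ (i.val + 1) % k = s.val % k then 1 else 0) := by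
    intro s X Y
    by_cases h1 : s.val < k * q <;> by_cases h2 : i.val % k = s.val % k <;>
      by_cases h3 : (i.val + 1) % k = s.val % k <;> simp [h1, h2, h3, mul_add]
  have hvec : ∀ (s : Fin m) (X : ℝ), (if s.val < k * q ∧ s.val % k = 0 then X else 0) =
      X * (if s.val < k * q ∧ 0 % k = s.val % k then 1 else 0) := by
    intro s X
    rw [Nat.zero_mod]
    simp [eq_comm]
  simp_rw [hsplit, hvec]
  have hclass : ∀ (X : ℝ) (v : ℕ),
      ∑ s : Fin m, X * (if s.val < k * q ∧ v % k = s.val % k then (1 : ℝ) else 0) = X * q :=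
    fun X v => by rw [← Finset.mul_sum, sum_class_eq hk hq]
  rw [Finset.sum_add_distrib, Finset.sum_add_distrib, Finset.sum_add_distrib, hclass, hclass,
    hclass]
  simp only [Finset.sum_const, Finset.card_univ, Fintype.card_fin, nsmul_eq_mul]
  -- The `β` term replaces the missing edge beyond the last coordinate: it acts as if the geometric
  -- sequence went on, so the finite path has an exactly geometric minimizer.
  have hlast : a * (if i.val + 1 < b then ρ * θ ^ i.val - ρ * θ ^ (i.val + 1) else 0) * q +
      m * (β * if i.val + 1 = b then ρ * θ ^ i.val else 0) = a * q * (1 - θ) * (ρ * θ ^ i.val) := by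
    have hi := i.2
    by_cases h : i.val + 1 < b
    · rw [if_pos h, if_neg h.ne]
      ring
    · rw [if_neg h, if_pos (by omega), ← hβ]
      ring
  by_cases h0 : i.val = 0
  · simp only [h0, zero_add, pow_zero, mul_one, Nat.le_zero, one_ne_zero, if_false, mul_zero,
      zero_mul, if_true, pow_one] at hlast ⊢
    rw [div_mul_cancel₀ _ hq']
    linear_combination hlast
  · obtain ⟨p, hp⟩ := Nat.exists_eq_succ_of_ne_zero h0
    rw [if_neg h0, if_pos (by omega : 1 ≤ i.val)]
    rw [hp] at hlast ⊢
    simp only [Nat.succ_eq_add_one, Nat.add_sub_cancel] at hlast ⊢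
    linear_combination hlast + ρ * θ ^ p * hs

/-- The linear term behaves like an edge of class `0` entering the path at coordinate `0`; it
obstructs only `t = 0`. -/
lemma hardVec_mem {q t : ℕ} {c₀ : ℝ} {s : Fin m} (h : s.val < k * q → t % k ≠ s.val % k) :
    hardVec m b k q c₀ s ∈ initialSubspace b t := by
  intro i hi
  simp only [hardVec]
  split_ifs with h1 h2
  · have ht : t = 0 := by omega
    exact absurd (by rw [ht, Nat.zero_mod, h1.2]) (h h1.1)
  · rfl
  · rfl

/-- Fewer than `k` indices miss one of any `k` consecutive classes. -/
lemma exists_missing_class {ι : Type*} (S : Multiset ι) (g : ι → ℕ) (k t : ℕ) (hS : S.card < k) :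
    ∃ t', t ≤ t' ∧ t' ≤ t + (k - 1) ∧ ∀ i ∈ S, t' % k ≠ g i % k := by
  by_contra! hcon
  have hsub : (Finset.Ico t (t + k)).image (· % k) ⊆ (S.map fun i => g i % k).toFinset := by
    intro x hx
    obtain ⟨t', ht', rfl⟩ := Finset.mem_image.1 hx
    rw [Finset.mem_Ico] at ht'
    obtain ⟨i, hi, h⟩ := hcon t' ht'.1 (by omega)
    rw [Multiset.mem_toFinset, Multiset.mem_map]
    exact ⟨i, hi, h.symm⟩
  have h1 := Finset.card_le_card hsub
  rw [Finset.card_image_of_injOn (by exact_mod_cast Nat.mod_injOn_Ico t k), Nat.card_Ico] at h1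
  have h2 := Multiset.toFinset_card_le (S.map fun i => g i % k)
  rw [Multiset.card_map] at h2
  omega

lemma IsOutput.mem_blockSubspace (hk : 2 ≤ k) {q r : ℕ} {ν a β c₀ : ℝ} (hν : 0 ≤ ν) (ha : 0 ≤ a)
    (hβ : 0 ≤ β) {D : DataDistribution m n r} {l : Fin n} (hD : D ∉ crowded k l) {H : ℕ}
    {x : EuclideanSpace ℝ (Fin (n * b))}
    (hx : IsOutput (fun i => quadratic (familyOp (hardOp m b hk q ν a β) i)
      (familyVec (hardVec m b k q c₀) i)) (localData D) H x) :
    x ∈ blockSubspace b l (H * (k - 1)) := by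
  have hA : ∀ s : Fin m, IsSymmPos (hardOp m b hk q ν a β s) := fun s =>
    isSymmPos_chainOp hν (by split_ifs <;> simp [ha]) hβ
  refine IsOutput.mem_of_chain (blockSubspace_mono l) (isSymmPos_familyOp hA)
    (fun t => diagonal_mem_blockSubspace l t) (fun j t => ?_) hx
  have hcard : ((localData D j).filter fun i => i ∈ blockIndices m l).card < k := by
    by_contra! h
    exact hD (Finset.mem_filter.2 ⟨Finset.mem_univ _, j, h⟩)
  obtain ⟨t', h1, h2, h3⟩ := exists_missing_class _
    (fun i => ((finProdFinEquiv.symm i).1 : ℕ)) k t hcard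
  refine ⟨t', h1, h2, fun i hi => ?_⟩
  have h4 : (finProdFinEquiv.symm i).2 = l → t' % k ≠ (finProdFinEquiv.symm i).1.val % k :=
    fun h => h3 i (Multiset.mem_filter.2 ⟨hi, mem_blockIndices.2 h⟩)
  refine ⟨fun y hy => fromBlock_mem_blockSubspace fun h => ?_,
    fromBlock_mem_blockSubspace fun h => hardVec_mem fun _ => h4 h⟩
  rw [h]
  exact chainOp_mem_initialSubspace (h4 h) hy

end HardFamily

/-! ### The distance to the minimizer -/

/-- For an infinite series the tail is exactly `p ^ J` times the whole; the factor `1/2` pays for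
the truncation at `b`. -/
lemma half_mul_geom_sum_lt {p : ℝ} (hp0 : 0 < p) (hp1 : p < 1) {J b : ℕ} (h : 2 * p ^ b < p ^ J) :
    p ^ J / 2 * ∑ i ∈ Finset.range b, p ^ i < ∑ i ∈ Finset.Ico J b, p ^ i := by
  have hJb : J ≤ b := by
    by_contra! hlt
    have := pow_le_pow_of_le_one hp0.le hp1.le hlt.le
    have := pow_pos hp0 b
    linarith
  have h1 : (∑ i ∈ Finset.range b, p ^ i) * (1 - p) = 1 - p ^ b := by
    have := geom_sum_mul p b
    linarith
  have h2 : (∑ i ∈ Finset.range J, p ^ i) * (1 - p) = 1 - p ^ J := by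
    have := geom_sum_mul p J
    linarith
  rw [Finset.sum_Ico_eq_sub _ hJb]
  have hpb := pow_pos hp0 b
  have hpJ := pow_pos hp0 J
  refine lt_of_mul_lt_mul_right (a := 1 - p) ?_ (by linarith)
  rw [sub_mul, h2, mul_assoc, h1]
  nlinarith

lemma norm_sq_geometric (b : ℕ) (ρ θ : ℝ) :
    ‖(WithLp.toLp 2 fun j : Fin b => ρ * θ ^ (j : ℕ) : EuclideanSpace ℝ (Fin b))‖ ^ 2 =
      ρ ^ 2 * ∑ i ∈ Finset.range b, (θ ^ 2) ^ i := by
  rw [EuclideanSpace.norm_sq_eq, Finset.mul_sum,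
    ← Fin.sum_univ_eq_sum_range fun i => ρ ^ 2 * (θ ^ 2) ^ i]
  refine Finset.sum_congr rfl fun i _ => ?_
  rw [Real.norm_eq_abs, sq_abs]
  ring

lemma le_norm_sub_geometric {b J : ℕ} {ρ θ : ℝ} {v : EuclideanSpace ℝ (Fin b)}
    (hv : v ∈ initialSubspace b J) :
    ρ ^ 2 * ∑ i ∈ Finset.Ico J b, (θ ^ 2) ^ i ≤
      ‖v - WithLp.toLp 2 fun j : Fin b => ρ * θ ^ (j : ℕ)‖ ^ 2 := by
  have h : ∑ i ∈ Finset.Ico J b, (θ ^ 2) ^ i =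
      ∑ i : Fin b, if J ≤ i.val then (θ ^ 2) ^ i.val else 0 := by
    rw [Fin.sum_univ_eq_sum_range fun i => if J ≤ i then (θ ^ 2) ^ i else 0, ← Finset.sum_filter]
    congr 1
    ext i
    simp [and_comm]
  rw [EuclideanSpace.norm_sq_eq, h, Finset.mul_sum]
  refine Finset.sum_le_sum fun i _ => ?_
  rw [Real.norm_eq_abs, sq_abs]
  split_ifs with hi
  · rw [PiLp.sub_apply, hv i hi]
    exact le_of_eq (by ring)
  · rw [mul_zero]
    exact sq_nonneg _

/-! ### The expected accuracy -/

/-- If each block that is not crowded contributes at least `g`, the expected accuracy is at least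
`n g` times a lower bound for the probability that a block is not crowded. -/
lemma le_expectedGap {m n : ℕ} {α : ℝ} (hα : 0 ≤ α) (hn : 0 < n)
    (hm : machineThreshold α ≤ (m : ℝ)) {k : ℕ} (hk : loadConst α * Real.log m ≤ k)
    (A : Algorithm.{u} m n α) {d : ℕ} (f : Fin (m * n) → EuclideanSpace ℝ (Fin d) → ℝ)
    (xstar : EuclideanSpace ℝ (Fin d)) (H : ℕ) {g : ℝ} (hg : 0 ≤ g)
    (hgap : ∀ D x, IsOutput f (localData D) H x →
      ∑ l : Fin n, (if (D : DataDistribution m n ⌊α * (n : ℝ)⌋₊) ∈ crowded k l then 0 else g) ≤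
        average f x - average f xstar) :
    ENNReal.ofReal (n * g * probConst α) ≤ expectedGap A f xstar H := by
  -- An outcome exists because the measure has total mass one; hence the number of data
  -- distributions, a denominator below, is positive.
  have hne : Nonempty A.Ω := by
    by_contra h
    rw [not_nonempty_iff] at h
    have h1 := measure_univ (μ := A.P)
    rw [Set.eq_empty_of_isEmpty Set.univ, measure_empty] at h1
    exact zero_ne_one h1
  obtain ⟨ω₀⟩ := hne
  set r := ⌊α * (n : ℝ)⌋₊ with hr
  have hcard : 0 < Fintype.card (DataDistribution m n r) := Fintype.card_pos_iff.2 ⟨A.data ω₀⟩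
  have hcard' : (0 : ℝ) < Fintype.card (DataDistribution m n r) := by exact_mod_cast hcard
  let φ : DataDistribution m n r → ℝ := fun D => ∑ l : Fin n, (if D ∈ crowded k l then 0 else g)
  have hφ0 : ∀ D, 0 ≤ φ D := fun D => Finset.sum_nonneg fun l _ => by split_ifs <;> simp [hg]
  have h1 : ∫⁻ ω, ENNReal.ofReal (φ (A.data ω)) ∂A.P ≤ expectedGap A f xstar H :=
    lintegral_mono fun ω => ENNReal.ofReal_le_ofReal (hgap _ _ (A.output_valid f H ω))
  refine le_trans ?_ h1
  rw [A.lintegral_data fun D => ENNReal.ofReal (φ D), ← ENNReal.ofReal_sum_of_nonneg fun D _ => hφ0 D,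
    ← ENNReal.ofReal_natCast, ← ENNReal.ofReal_div_of_pos hcard']
  refine ENNReal.ofReal_le_ofReal ?_
  rw [le_div_iff₀ hcard', Finset.sum_comm]
  have h2 : ∀ l : Fin n, g * probConst α * Fintype.card (DataDistribution m n r) ≤
      ∑ D : DataDistribution m n r, (if D ∈ crowded k l then 0 else g) := by
    intro l
    have h3 := card_crowded_le (m := m) (r := r) (α := α) (Nat.floor_le (by positivity)) hn k l
    have h4 := mul_le_mul_of_nonneg_right (crowding_bound hα hm hk) hcard'.le
    have h5 : ∑ D : DataDistribution m n r, (if D ∈ crowded k l then 0 else g) =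
        g * (Fintype.card (DataDistribution m n r) -
          (crowded k l : Finset (DataDistribution m n r)).card) := by
      have h6 : ∀ D : DataDistribution m n r, (if D ∈ crowded k l then 0 else g) =
          g - if D ∈ crowded k l then g else 0 := fun D => by split_ifs <;> simp
      simp_rw [h6]
      rw [Finset.sum_sub_distrib, Finset.sum_ite_mem, Finset.univ_inter]
      simp only [Finset.sum_const, Finset.card_univ, nsmul_eq_mul]
      ring
    rw [h5, mul_assoc]
    refine mul_le_mul_of_nonneg_left ?_ hg
    linarith
  calc n * g * probConst α * Fintype.card (DataDistribution m n r)
      = ∑ _l : Fin n, g * probConst α * Fintype.card (DataDistribution m n r) := by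
        simp only [Finset.sum_const, Finset.card_univ, Fintype.card_fin, nsmul_eq_mul]
        ring
    _ ≤ _ := Finset.sum_le_sum fun l _ => h2 l

/-! ### The hard instance -/

/-- The number of classes and the number of functions of each class. -/
lemma exists_classes {α : ℝ} {m : ℕ} (hm : machineThreshold α ≤ (m : ℝ)) :
    ∃ k q : ℕ, 2 ≤ k ∧ 0 < q ∧ k * q ≤ m ∧ loadConst α * Real.log m ≤ k ∧
      ((k - 1 : ℕ) : ℝ) ≤ loadConst α * Real.log m ∧
      3 * (m / q : ℝ) ≤ 8 * (loadConst α * Real.log m) := by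
  set T := loadConst α * Real.log m with hT
  have hT3 : 3 ≤ T := by
    have h1 := loadConst_ge α
    have h2 := two_le_log hm
    nlinarith
  have hTm : T + 1 ≤ m := loadConst_mul_log_add_one_le hm
  have hk1 : T ≤ ⌈T⌉₊ := Nat.le_ceil T
  have hk2 : (⌈T⌉₊ : ℝ) < T + 1 := Nat.ceil_lt_add_one (by linarith)
  set k := ⌈T⌉₊ with hk
  have hk3 : 3 ≤ k := by exact_mod_cast hT3.trans hk1
  have hkm : k ≤ m := by exact_mod_cast hk2.le.trans hTm
  have hq : 0 < m / k := Nat.div_pos hkm (by omega)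
  refine ⟨k, m / k, by omega, hq, Nat.mul_div_le m k, hk1, ?_, ?_⟩
  · rw [Nat.cast_sub (by omega), Nat.cast_one]
    linarith
  -- Rounding down costs at most a factor `2`, so `m / q ≤ 2 k`; then `6 k ≤ 6 (T + 1) ≤ 8 T`
  -- because `T ≥ 3`.
  · have h1 : m < k * (m / k + 1) := Nat.lt_mul_div_succ m (by omega)
    have h2 : k * (m / k + 1) ≤ 2 * k * (m / k) := by nlinarith
    have h3 : (m : ℝ) ≤ 2 * k * (m / k : ℕ) := by exact_mod_cast h1.le.trans h2
    have hq' : (0 : ℝ) < (m / k : ℕ) := by exact_mod_cast hq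
    have h4 : (m : ℝ) / (m / k : ℕ) ≤ 2 * k := by rwa [div_le_iff₀ hq']
    linarith

lemma exists_decay_rate {m n q : ℕ} {L μ T : ℝ} (hm : 0 < m) (hn : 0 < n) (hq : 0 < q)
    (hμ : 0 < μ) (hΓ : 0 < L / μ / n - 1) (hmq : 3 * (m / q : ℝ) ≤ 8 * T) :
    ∃ θ : ℝ, 0 < θ ∧ θ < 1 ∧ m * (n * μ) * θ = (L - n * μ) / 3 * q * (1 - θ) ^ 2 ∧
      -Real.log θ ≤ Real.sqrt (8 * T / (L / μ / n - 1)) := by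
  have hLΓ : L - n * μ = n * μ * (L / μ / n - 1) := by field_simp
  rw [hLΓ]
  generalize L / μ / n - 1 = Γ at hΓ ⊢
  obtain ⟨θ, hθ0, hθ1, hθeq, hθlog⟩ := exists_decay (s := 3 * (m / q : ℝ) / Γ) (by positivity)
  refine ⟨θ, hθ0, hθ1, ?_, hθlog.trans (Real.sqrt_le_sqrt (by gcongr))⟩
  rw [hθeq]
  field_simp

lemma exists_hard_family {m n k q : ℕ} (hk : 2 ≤ k) (hq : 0 < q) (hkq : k * q ≤ m) {L μ : ℝ}
    (hn : 0 < n) (hμ : 0 < μ) (hL : n * μ < L) {θ : ℝ} (hθ0 : 0 < θ) (hθ1 : θ < 1)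
    (hθ : m * (n * μ) * θ = (L - n * μ) / 3 * q * (1 - θ) ^ 2) {b : ℕ} (ρ : ℝ) :
    ∃ f : Fin (m * n) → EuclideanSpace ℝ (Fin (n * b)) → ℝ,
      ∃ w : EuclideanSpace ℝ (Fin b), w = (WithLp.toLp 2 fun j : Fin b => ρ * θ ^ (j : ℕ)) ∧
        IsInstance L μ f ∧ (∀ x, average f (copies n w) ≤ average f x) ∧
        ∀ (r : ℕ) (D : DataDistribution m n r) (H : ℕ) (x : EuclideanSpace ℝ (Fin (n * b))),
          IsOutput f (localData D) H x →
          ∑ l : Fin n, (if D ∈ crowded k l then 0 else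
            μ / 2 * (ρ ^ 2 * ∑ i ∈ Finset.Ico (H * (k - 1)) b, (θ ^ 2) ^ i)) ≤
          average f x - average f (copies n w) := by
  have hm : 0 < m := lt_of_lt_of_le (Nat.mul_pos (by omega) hq) hkq
  have hm' : (0 : ℝ) < m := by exact_mod_cast hm
  have hq' : (0 : ℝ) < q := by exact_mod_cast hq
  -- The operator norm is at most `n μ + 2 a + β`; as `β ≤ a`, this value of `a` keeps it within
  -- `L`.
  obtain ⟨a, ha⟩ : ∃ a, a = (L - n * μ) / 3 := ⟨_, rfl⟩
  rw [← ha] at hθ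
  have ha0 : 0 < a := by
    rw [ha]
    linarith
  obtain ⟨β, hβdef⟩ : ∃ β, β = a * q * (1 - θ) / m := ⟨_, rfl⟩
  have hβ : m * β = a * q * (1 - θ) := by rw [hβdef]; field_simp
  have hβ0 : 0 ≤ β := by
    have : 0 < 1 - θ := by linarith
    rw [hβdef]
    positivity
  have hqm : (q : ℝ) ≤ m := by
    exact_mod_cast (Nat.le_mul_of_pos_left q (by omega : 0 < k)).trans hkq
  have hβa : β ≤ a := by
    rw [hβdef, div_le_iff₀ hm', mul_assoc]
    refine mul_le_mul_of_nonneg_left ?_ ha0.le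
    nlinarith
  have hν : 0 ≤ n * μ := by positivity
  have has : ∀ s : Fin m, 0 ≤ (if s.val < k * q then a else 0) ∧
      (if s.val < k * q then a else 0) ≤ a := fun s => by
    split_ifs <;> simp [ha0.le]
  have hA : ∀ s : Fin m, IsSymmPos (hardOp m b hk q (n * μ) a β s) := fun s =>
    isSymmPos_chainOp hν (has s).1 hβ0
  have hAμ : ∀ (s : Fin m) x, n * μ * ‖x‖ ^ 2 ≤
      inner ℝ (hardOp m b hk q (n * μ) a β s x) x := fun s x =>
    le_inner_chainOp (has s).1 hβ0 x
  have hAL : ∀ (s : Fin m) x, ‖hardOp m b hk q (n * μ) a β s x‖ ≤ L * ‖x‖ := fun s x => by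
    refine (norm_chainOp_le hν (has s).1 hβ0 x).trans ?_
    refine mul_le_mul_of_nonneg_right ?_ (norm_nonneg x)
    have := (has s).2
    linarith
  have hsum := sum_hardOp_geometric (b := b) (ρ := ρ) hk hq hkq hβ hθ
  refine ⟨_, _, rfl, isInstance_family hA hAL (hν.trans hL.le) hAμ hm hn,
    average_family_le hA hAμ hμ hsum hm hn, fun r D H x hx => ?_⟩
  have hρ : ∀ l : Fin n, D ∉ crowded k l → ρ ^ 2 * ∑ i ∈ Finset.Ico (H * (k - 1)) b, (θ ^ 2) ^ i ≤
      ‖toBlock b l x - WithLp.toLp 2 fun j : Fin b => ρ * θ ^ (j : ℕ)‖ ^ 2 := fun l hD =>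
    le_norm_sub_geometric (hx.mem_blockSubspace hk hν ha0.le hβ0 hD)
  have hτ : 0 ≤ ρ ^ 2 * ∑ i ∈ Finset.Ico (H * (k - 1)) b, (θ ^ 2) ^ i := by positivity
  generalize ρ ^ 2 * ∑ i ∈ Finset.Ico (H * (k - 1)) b, (θ ^ 2) ^ i = τ at hρ hτ ⊢
  refine le_trans ?_ (le_average_family_sub hA hAμ hsum hm hn x)
  rw [Finset.mul_sum]
  refine Finset.sum_le_sum fun l _ => ?_
  split_ifs with hD
  · positivity
  · exact mul_le_mul_of_nonneg_left (hρ l hD) (by positivity)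

/-- The dimension can be chosen so that the tail of the geometric vector is at least half as long
as that of an infinite geometric sequence. -/
lemma exists_geometric {θ : ℝ} (hθ0 : 0 < θ) (hθ1 : θ < 1) {r : ℝ} (hr : 0 < r) (N : ℕ) :
    ∃ (b : ℕ) (ρ : ℝ),
      ‖(WithLp.toLp 2 fun j : Fin b => ρ * θ ^ (j : ℕ) : EuclideanSpace ℝ (Fin b))‖ = r ∧
      ∀ J ≤ N, (θ ^ 2) ^ J / 2 * r ^ 2 < ρ ^ 2 * ∑ i ∈ Finset.Ico J b, (θ ^ 2) ^ i := by
  obtain ⟨p, hp⟩ : ∃ p, p = θ ^ 2 := ⟨_, rfl⟩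
  have hp0 : 0 < p := by rw [hp]; positivity
  have hp1 : p < 1 := by rw [hp]; nlinarith
  obtain ⟨b, hb⟩ := exists_pow_lt_of_lt_one (half_pos (pow_pos hp0 N)) hp1
  have hb0 : b ≠ 0 := by
    rintro rfl
    rw [pow_zero] at hb
    have := pow_le_one₀ (n := N) hp0.le hp1.le
    linarith
  have hS0 : 0 < ∑ i ∈ Finset.range b, p ^ i :=
    Finset.sum_pos (fun i _ => by positivity) (by simpa using hb0)
  obtain ⟨ρ, hρ⟩ : ∃ ρ, ρ = r / Real.sqrt (∑ i ∈ Finset.range b, p ^ i) := ⟨_, rfl⟩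
  have hρ0 : 0 < ρ := by rw [hρ]; positivity
  have hρS : ρ ^ 2 * ∑ i ∈ Finset.range b, p ^ i = r ^ 2 := by
    rw [hρ, div_pow, Real.sq_sqrt hS0.le, div_mul_cancel₀ _ hS0.ne']
  refine ⟨b, ρ, ?_, fun J hJ => ?_⟩
  · refine (pow_left_inj₀ (norm_nonneg _) hr.le two_ne_zero).1 ?_
    rw [norm_sq_geometric, ← hp, hρS]
  · have hpJ : 2 * p ^ b < p ^ J := by
      have := pow_le_pow_of_le_one hp0.le hp1.le hJ
      linarith
    have := mul_lt_mul_of_pos_left (half_mul_geom_sum_lt hp0 hp1 hpJ) (pow_pos hρ0 2)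
    rw [← hp, ← hρS]
    linarith

lemma exists_hard_instance {α : ℝ} (hα : 0 ≤ α) {m n : ℕ} {L μ : ℝ} (hn : 1 ≤ n) (hμ : 0 < μ)
    (hm : machineThreshold α ≤ (m : ℝ)) {ε r : ℝ} (hε : 0 < ε) (hr : 0 < r)
    (hB : 0 < roundsBound α m n L μ ε r) :
    ∃ (b : ℕ) (f : Fin (m * n) → EuclideanSpace ℝ (Fin (n * b)) → ℝ)
      (wstar : EuclideanSpace ℝ (Fin b)),
      IsInstance L μ f ∧ ‖wstar‖ = r ∧
      (∀ x, average f (copies n wstar) ≤ average f x) ∧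
      ∀ (A : Algorithm.{u} m n α) (H : ℕ),
        expectedGap A f (copies n wstar) H ≤ ENNReal.ofReal ε →
        roundsBound α m n L μ ε r ≤ (H : ℝ) := by
  obtain ⟨k, q, hk, hq, hkq, hTk, hKT, hmq⟩ := exists_classes hm
  have hT0 : 0 < loadConst α * Real.log m := by
    have hC := loadConst_ge α
    have hℓ := two_le_log hm
    positivity
  have hp := probConst_pos α
  have hn' : (0 : ℝ) < n := by exact_mod_cast hn
  have hm0 : 0 < m := lt_of_lt_of_le (Nat.mul_pos (by omega) hq) hkq
  obtain ⟨X, hX⟩ : ∃ X, X = probConst α * (μ * n * r ^ 2 / (4 * ε)) := ⟨_, rfl⟩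
  have hX0 : 0 < X := by rw [hX]; positivity
  have hBdef : roundsBound α m n L μ ε r = Real.sqrt (L / μ / n - 1) /
      (4 * Real.sqrt 2 * (loadConst α * Real.log m) ^ (3 / 2 : ℝ)) * Real.log X := by
    rw [hX]
    rfl
  -- A positive bound forces `κ > n`, as the real square root vanishes on nonpositive numbers;
  -- likewise its logarithm must be positive.
  have hΓ : 0 < L / μ / n - 1 := by
    by_contra! h
    rw [hBdef, Real.sqrt_eq_zero_of_nonpos h, zero_div, zero_mul] at hB
    exact lt_irrefl _ hB
  have hΛ : 0 < Real.log X := by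
    by_contra! h
    rw [hBdef] at hB
    exact absurd hB (not_lt.2 (mul_nonpos_of_nonneg_of_nonpos (by positivity) h))
  have hL : n * μ < L := by
    rw [sub_pos, lt_div_iff₀ hn', one_mul, lt_div_iff₀ hμ] at hΓ
    exact hΓ
  obtain ⟨θ, hθ0, hθ1, hθ, hu⟩ := exists_decay_rate hm0 hn hq hμ hΓ hmq
  obtain ⟨b, ρ, hw, htail⟩ :=
    -- Only `H` below the bound must be refuted, so this range of tails suffices and `b` is fixed
    -- before the algorithm and `H`.
    exists_geometric hθ0 hθ1 hr (⌈roundsBound α m n L μ ε r⌉₊ * (k - 1))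
  obtain ⟨f, w, rfl, hf, hmin, hgap⟩ :=
    exists_hard_family hk hq hkq hn hμ hL hθ0 hθ1 hθ (b := b) ρ
  refine ⟨b, f, _, hf, hw, hmin, fun A H hH => ?_⟩
  by_contra! hlt
  have hτ := htail (H * (k - 1))
    (Nat.mul_le_mul_right _ (by exact_mod_cast hlt.le.trans (Nat.le_ceil _)))
  have hle := (ENNReal.ofReal_le_ofReal_iff hε.le).1
    ((le_expectedGap hα hn hm hTk A f _ H (by positivity) fun D x => hgap _ D H x).trans hH)
  have hdecay : 2 * H * (k - 1 : ℕ) * -Real.log θ ≤ Real.log X :=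
    decay_rounds_le hT0 (Nat.cast_nonneg _) hKT hΓ (Nat.cast_nonneg _) hu hΛ.le
      (by rw [← hBdef]; exact hlt.le)
  have hpX : 1 ≤ (θ ^ 2) ^ (H * (k - 1)) * X := by
    have h1 : (θ ^ 2) ^ (H * (k - 1)) =
        Real.exp (-(2 * H * (k - 1 : ℕ) * -Real.log θ)) := by
      rw [← pow_mul, ← Real.exp_log (pow_pos hθ0 _), Real.log_pow]
      congr 1
      push_cast
      ring
    rw [h1, ← Real.exp_log hX0, ← Real.exp_add]
    exact Real.one_le_exp (by linarith)
  have hεX : ε * X = probConst α * (μ * n * r ^ 2) / 4 := by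
    rw [hX]
    field_simp
  have h1 : ε ≤ (θ ^ 2) ^ (H * (k - 1)) * (ε * X) := by
    have := mul_le_mul_of_nonneg_left hpX hε.le
    linarith
  -- The contradiction comes from the strict tail estimate: the expected gap exceeds `(θ²)^J ·
  -- probConst α · μ n r² / 4` with `J = H (k - 1)`, which is at least `ε`.
  have h2 := mul_lt_mul_of_pos_left hτ (show 0 < n * (μ / 2) * probConst α by positivity)
  rw [hεX] at h1
  linarith

end DistOpt

end

theorem mainTheorem1 (α : ℝ) (hα : 0 ≤ α) :
    (∀ (m n : ℕ) (L μ : ℝ), 1 ≤ n → 0 < μ → (n : ℝ) ≤ L / μ →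
      DistOpt.machineThreshold α ≤ (m : ℝ) →
      ∀ ε r : ℝ, 0 < ε → 0 < r →
        ∃ (b : ℕ) (f : Fin (m * n) → EuclideanSpace ℝ (Fin (n * b)) → ℝ)
          (wstar : EuclideanSpace ℝ (Fin b)),
          DistOpt.IsInstance L μ f ∧ ‖wstar‖ = r ∧
          (∀ x, DistOpt.average f (DistOpt.copies n wstar) ≤ DistOpt.average f x) ∧
          ∀ (A : DistOpt.Algorithm.{u} m n α) (H : ℕ),
            DistOpt.expectedGap A f (DistOpt.copies n wstar) H ≤ ENNReal.ofReal ε →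
            DistOpt.roundsBound α m n L μ ε ‖wstar‖ ≤ (H : ℝ)) ∧
    (∀ δ : ℝ, 0 < δ → ∃ c : ℝ, 0 < c ∧
      ∀ (m n : ℕ) (L μ ε r : ℝ), 1 ≤ n → 0 < μ → (1 + δ) * (n : ℝ) ≤ L / μ →
        DistOpt.machineThreshold α ≤ (m : ℝ) → 0 < ε → 0 < r →
        (1 + δ) * (4 * ε) ≤ DistOpt.probConst α * (μ * (n : ℝ) * r ^ 2) →
        c * Real.sqrt (L / μ / ((n : ℝ) * Real.log (m : ℝ) ^ 3)) *
            Real.log (μ * (n : ℝ) * r ^ 2 / ε) ≤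
          DistOpt.roundsBound α m n L μ ε r) := by
  refine ⟨fun m n L μ hn hμ hκ hm ε r hε hr => ?_, fun δ hδ => DistOpt.roundsBound_order hδ⟩
  -- A nonpositive bound (`κ = n`, or `ε` too large) holds for any instance, and the path
  -- construction needs `κ > n`.
  rcases le_or_gt (DistOpt.roundsBound α m n L μ ε r) 0 with hB | hB
  · have hm0 : 0 < m := by
      have : (0 : ℝ) < m := (Real.exp_pos _).trans_le ((le_max_left _ _).trans hm)
      exact_mod_cast this
    obtain ⟨b, f, w, hf, hw, hmin⟩ := DistOpt.exists_instance hm0 hn hμ hκ hr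
    exact ⟨b, f, w, hf, hw, hmin, fun A H _ => by rw [hw]; exact hB.trans (Nat.cast_nonneg H)⟩
  · obtain ⟨b, f, w, hf, hw, hmin, h⟩ := DistOpt.exists_hard_instance hα hn hμ hm hε hr hB
    exact ⟨b, f, w, hf, hw, hmin, by rw [hw]; exact h⟩
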